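/- Let $X$ be a compact connected complex manifold of dimension $n\ge 1$ with a Kähler form $\omega\in 2\pi c_1(X)$ (so $X$ is a Fano manifold), and let $h_\omega$ be the smooth real function determined by $\mathrm{Ric}(\omega)=\omega+i\partial\bar\partial h_\omega$ and $\int_X(e^{h_\omega}-1)\,\omega^n=0$. Write $V:=\int_X\omega^n$, and for a smooth real function $\varphi$ with $\omega_\varphi:=\omega+i\partial\bar\partial\varphi>0$ set $$\nu_\omega(\varphi)=\frac1V\int_X \Big(\log\frac{\omega_\varphi^n}{\omega^n}+\varphi-h_\omega\Big)\omega_\varphi^n-\frac1{n+1}\sum_{k=0}^n\frac1V\int_X \varphi\,\omega^k\wedge\omega_\varphi^{n-k}+\frac1V\int_X h_\omega\,\omega^n,$$ $$E_{1,\omega}(\varphi)=\frac1V\int_X \Big(\log\frac{\omega_\varphi^n}{\omega^n}-h_\omega\Big)\big(\mathrm{Ric}(\omega_\varphi)+\omega\big)\wedge\omega_\varphi^{n-1}+\sum_{k=0}^n\frac{b_k}{n+1}\frac1V\int_X \varphi\,\omega^k\wedge\omega_\varphi^{n-k}+\frac1V\int_X h_\omega\big(\mathrm{Ric}(\omega)+\omega\big)\wedge\omega^{n-1},$$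 where $b_0=b_1=n-1$ and $b_k=-2$ for $k\ge2$ (the K-energy and the Chen–Tian energy with reference metric $\omega$). Put $\nu_\omega(\omega_\varphi):=\nu_\omega(\varphi)$ and $E_{1,\omega}(\omega_\varphi):=E_{1,\omega}(\varphi)$, for any potential $\varphi$ of the metric $\omega_\varphi$. There is a constant $C_\omega$, depending only on $\omega$, such that for every Kähler–Ricci flow $(\omega_t)_{t\in[0,+\infty)}$, $\frac{d}{dt}\omega_t=\omega_t-\mathrm{Ric}(\omega_t)$, in the class $2\pi c_1(X)$, $$E_{1,\omega}(\omega_t)\ \ge\ 2\,\nu_\omega(\omega_t)+C_\omega\qquad\text{for all }t\ge0 .$$ Moreover, with the same constant, if $\omega_t=\omega+i\partial\bar\partial\varphi_t$ with $\dot\varphi_t=\log\frac{\omega_t^n}{\omega^n}+\varphi_t-h_\omega$ for all $t\ge 0$, then $$E_{1,\omega}(\varphi_t)=2\,\nu_\omega(\varphi_t)+\frac1V\int_X i\partial\dot\varphi_t\wedge\bar\partial\dot\varphi_t\wedge\omega_t^{n-1}+C_\omega\qquad\text{for all }t\ge0 .$$ -/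

import Mathlib

noncomputable section

namespace KahlerRicci

open scoped Manifold ContDiff ComplexOrder

/-! Coordinates on a complex manifold of dimension `n` take values in `Fin n → ℂ`. -/

/-- Wirtinger derivative `∂f/∂z_j`. -/
def dz {n : ℕ} (j : Fin n) (f : (Fin n → ℂ) → ℂ) (y : Fin n → ℂ) : ℂ :=
  (1 / 2 : ℂ) * (fderiv ℝ f y (Pi.single j 1) - Complex.I * fderiv ℝ f y (Pi.single j Complex.I))

/-- Wirtinger derivative `∂f/∂z̄_j`. -/
def dzbar {n : ℕ} (j : Fin n) (f : (Fin n → ℂ) → ℂ) (y : Fin n → ℂ) : ℂ :=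
  (1 / 2 : ℂ) * (fderiv ℝ f y (Pi.single j 1) + Complex.I * fderiv ℝ f y (Pi.single j Complex.I))

/-- Coefficients of a `(1,1)`-form: in the chart `e`, the form is
`i ∑ j k, (α e z) j k dz_j ∧ dz̄_k`. Only charts `e` of the atlas and points of `e.target` matter. -/
abbrev ChartForm (n : ℕ) (X : Type*) [TopologicalSpace X] : Type _ :=
  OpenPartialHomeomorph X (Fin n → ℂ) → (Fin n → ℂ) → Matrix (Fin n) (Fin n) ℂ

/-- A real form of top degree `2n`, given in each chart by its density with respect to Lebesgue
measure on `ℂⁿ` (with the complex orientation). -/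
abbrev TopForm (n : ℕ) (X : Type*) [TopologicalSpace X] : Type _ :=
  OpenPartialHomeomorph X (Fin n → ℂ) → (Fin n → ℂ) → ℝ

/-- Coefficients of the `(1,0)`-part `∑ j, (b e z) j dz_j` of the real one-form
`∑ j, (b_j dz_j + conj b_j dz̄_j)`. -/
abbrev ChartOneForm (n : ℕ) (X : Type*) [TopologicalSpace X] : Type _ :=
  OpenPartialHomeomorph X (Fin n → ℂ) → (Fin n → ℂ) → Fin n → ℂ

section Manifold

variable {n : ℕ} {X : Type*} [TopologicalSpace X]

/-- Complex Jacobian matrix of the change of coordinates `e' ∘ e⁻¹`. -/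
def jacobian (e e' : OpenPartialHomeomorph X (Fin n → ℂ)) (y : Fin n → ℂ) :
    Matrix (Fin n) (Fin n) ℂ :=
  Matrix.of fun j k => fderiv ℂ (fun z => e' (e.symm z)) y (Pi.single k 1) j

/-- `i∂∂̄f` for a real function `f` on `X`. -/
def ddbar (f : X → ℝ) : ChartForm n X := fun e y =>
  Matrix.of fun j k => dz j (dzbar k fun z => (f (e.symm z) : ℂ)) y

/-- `i∂f ∧ ∂̄f` for a real function `f` on `X`. -/
def gradForm (f : X → ℝ) : ChartForm n X := fun e y =>
  Matrix.of fun j k => dz j (fun z => (f (e.symm z) : ℂ)) y * dzbar k (fun z => (f (e.symm z) : ℂ)) y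

/-- The Ricci form `-i∂∂̄ log det (g_{jk})` of a Hermitian metric. -/
def ricci (g : ChartForm n X) : ChartForm n X := fun e y =>
  Matrix.of fun j k => - dz j (dzbar k fun z => (Real.log (g e z).det.re : ℂ)) y

/-- The exterior product `α₁ ∧ ⋯ ∧ αₙ` of `n` real `(1,1)`-forms. The factor `2 ^ n` comes from
`i dz ∧ dz̄ = 2 dx ∧ dy`. -/
def wedge (α : Fin n → ChartForm n X) : TopForm n X := fun e y =>
  2 ^ n * (∑ σ : Equiv.Perm (Fin n), ∑ τ : Equiv.Perm (Fin n),
    ((Equiv.Perm.sign σ : ℤ) : ℂ) * ((Equiv.Perm.sign τ : ℤ) : ℂ) *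
      ∏ i, α i e y (σ i) (τ i)).re

/-- `α ^ k ∧ β ^ (n - k)`, for `k ≤ n`. -/
def wedgePow (k : ℕ) (α β : ChartForm n X) : TopForm n X :=
  wedge fun i => if (i : ℕ) < k then α else β

variable [ChartedSpace (Fin n → ℂ) X]

/-- Equality of two forms on `X`. -/
def FormEq (α β : ChartForm n X) : Prop :=
  ∀ e ∈ atlas (Fin n → ℂ) X, ∀ y ∈ e.target, α e y = β e y

/-- A Hermitian metric on `X`: a smooth real `(1,1)`-form, positive definite at every point. -/
structure IsHermitianMetric (g : ChartForm n X) : Prop where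
  smooth : ∀ e ∈ atlas (Fin n → ℂ) X, ∀ j k, ContDiffOn ℝ ∞ (fun y => g e y j k) e.target
  compatible : ∀ e ∈ atlas (Fin n → ℂ) X, ∀ e' ∈ atlas (Fin n → ℂ) X, ∀ x ∈ e.source ∩ e'.source,
    g e (e x) = (jacobian e e' (e x)).transpose * g e' (e' x) * (jacobian e e' (e x)).map star
  posDef : ∀ e ∈ atlas (Fin n → ℂ) X, ∀ y ∈ e.target, (g e y).PosDef

/-- A Kähler form: a Hermitian metric `g` whose `(1,1)`-form is `d`-closed. -/
structure IsKahlerForm (g : ChartForm n X) : Prop extends IsHermitianMetric g where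
  closed : ∀ e ∈ atlas (Fin n → ℂ) X, ∀ y ∈ e.target, ∀ l j k,
    dz l (fun z => g e z j k) y = dz j (fun z => g e z l k) y ∧
      dzbar l (fun z => g e z j k) y = dzbar k (fun z => g e z j l) y

/-- A smooth real one-form on `X`. -/
structure IsRealOneForm (b : ChartOneForm n X) : Prop where
  smooth : ∀ e ∈ atlas (Fin n → ℂ) X, ∀ j, ContDiffOn ℝ ∞ (fun y => b e y j) e.target
  compatible : ∀ e ∈ atlas (Fin n → ℂ) X, ∀ e' ∈ atlas (Fin n → ℂ) X, ∀ x ∈ e.source ∩ e'.source,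
    ∀ j, b e (e x) j = ∑ l, jacobian e e' (e x) l j * b e' (e' x) l

/-- The exterior derivative of the real one-form `∑ j, (b_j dz_j + conj b_j dz̄_j)` is the
`(1,1)`-form `α`: the `(2,0)`-part of the derivative (and so its conjugate, the `(0,2)`-part)
vanishes, and the `(1,1)`-part `∑ j k, (∂_j conj b_k - ∂̄_k b_j) dz_j ∧ dz̄_k` is `α`. -/
def IsExteriorDeriv (b : ChartOneForm n X) (α : ChartForm n X) : Prop :=
  ∀ e ∈ atlas (Fin n → ℂ) X, ∀ y ∈ e.target, ∀ j k,
    dz j (fun z => b e z k) y = dz k (fun z => b e z j) y ∧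
      Complex.I * α e y j k = dz j (fun z => star (b e z k)) y - dzbar k (fun z => b e z j) y

/-- The real `(1,1)`-form `α` lies in the de Rham class `2π c₁(X)`, that is, in the class of the
Ricci form of a Hermitian metric on `X` (these forms are all cohomologous). -/
def InTwoPiC1 (α : ChartForm n X) : Prop :=
  ∃ (g : ChartForm n X) (b : ChartOneForm n X), IsHermitianMetric g ∧ IsRealOneForm b ∧
    IsExteriorDeriv b (α - ricci g)

/-- The function `log (η ^ n / ω₀ ^ n)` on `X`. -/
def logRatio (ω₀ η : ChartForm n X) (x : X) : ℝ :=
  Real.log (wedgePow n η η (chartAt (Fin n → ℂ) x) (chartAt (Fin n → ℂ) x x) /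
    wedgePow n ω₀ ω₀ (chartAt (Fin n → ℂ) x) (chartAt (Fin n → ℂ) x x))

/-- The space of Kähler potentials of `ω₀`: smooth real `φ` with `ω₀ + i∂∂̄φ > 0`. -/
structure IsKahlerPotential (ω₀ : ChartForm n X) (φ : X → ℝ) : Prop where
  smooth : ContMDiff 𝓘(ℝ, Fin n → ℂ) 𝓘(ℝ, ℝ) ∞ φ
  posDef : ∀ e ∈ atlas (Fin n → ℂ) X, ∀ y ∈ e.target, (ω₀ e y + ddbar φ e y).PosDef

/-- A solution `(ω_t)`, `t ∈ [0, ∞)`, in the class `2π c₁(X)`, smooth in space and time, of the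
Kähler–Ricci flow `dω_t/dt = ω_t - Ric ω_t`. -/
structure IsKahlerRicciFlow (ωt : ℝ → ChartForm n X) : Prop where
  kahler : ∀ t, 0 ≤ t → IsKahlerForm (ωt t)
  inClass : ∀ t, 0 ≤ t → InTwoPiC1 (ωt t)
  smooth : ∀ e ∈ atlas (Fin n → ℂ) X, ∀ j k,
    ContDiffOn ℝ ∞ (fun p : ℝ × (Fin n → ℂ) => ωt p.1 e p.2 j k) (Set.Ici 0 ×ˢ e.target)
  flow : ∀ e ∈ atlas (Fin n → ℂ) X, ∀ y ∈ e.target, ∀ j k, ∀ t, 0 ≤ t →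
    HasDerivWithinAt (fun s => ωt s e y j k) (ωt t e y j k - ricci (ωt t) e y j k) (Set.Ici 0) t

/-- Solutions `φ_t`, with time derivative `φ'_t`, of the flow of potentials
`dφ_t/dt = log (ω_{φ_t} ^ n / ω₀ ^ n) + φ_t - h`, where `ω_{φ_t} = ω₀ + i∂∂̄φ_t`. -/
structure IsPotentialFlow (ω₀ : ChartForm n X) (h : X → ℝ) (φ φ' : ℝ → X → ℝ) : Prop where
  potential : ∀ t, 0 ≤ t → IsKahlerPotential ω₀ (φ t)
  deriv : ∀ t, 0 ≤ t → ∀ x, HasDerivWithinAt (fun s => φ s x) (φ' t x) (Set.Ici 0) t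
  flow : ∀ t, 0 ≤ t → ∀ x, φ' t x = logRatio ω₀ (ω₀ + ddbar (φ t)) x + φ t x - h x

/-- A complex manifold is a smooth real manifold. -/
theorem isManifold_real [IsManifold 𝓘(ℂ, Fin n → ℂ) ω X] : IsManifold 𝓘(ℝ, Fin n → ℂ) ∞ X := by
  apply isManifold_of_contDiffOn
  intro e e' he he'
  have h := (contDiffGroupoid ω 𝓘(ℂ, Fin n → ℂ)).compatible he he'
  rw [contDiffGroupoid, mem_groupoid_of_pregroupoid] at h
  have h1 : ContDiffOn ℂ ω (e.symm ≫ₕ e') (e.symm ≫ₕ e').source := by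
    simpa [contDiffPregroupoid] using h.1
  simpa using (h1.restrict_scalars ℝ).of_le le_top

variable [T2Space X] [CompactSpace X] [IsManifold 𝓘(ℂ, Fin n → ℂ) ω X]

variable (n X) in
/-- A smooth partition of unity on `X` subordinate to the sources of the charts. -/
theorem exists_partition : ∃ ρ : SmoothPartitionOfUnity X 𝓘(ℝ, Fin n → ℂ) X Set.univ,
    ρ.IsSubordinate fun x => (chartAt (Fin n → ℂ) x).source := by
  have : IsManifold 𝓘(ℝ, Fin n → ℂ) ∞ X := isManifold_real
  exact SmoothPartitionOfUnity.exists_isSubordinate_chartAt_source _ _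

variable (n X) in
/-- A choice of such a partition of unity (integrals do not depend on it). -/
def partition : SmoothPartitionOfUnity X 𝓘(ℝ, Fin n → ℂ) X Set.univ :=
  (exists_partition n X).choose

/-- The integral `∫_X f Ω` of a function `f` against a top degree form `Ω`. -/
def integral (f : X → ℝ) (Ω : TopForm n X) : ℝ :=
  ∑ᶠ i : X, ∫ y in (chartAt (Fin n → ℂ) i).target,
    partition n X i ((chartAt (Fin n → ℂ) i).symm y) * f ((chartAt (Fin n → ℂ) i).symm y) *
      Ω (chartAt (Fin n → ℂ) i) y

/-- The average `(∫_X ω₀ ^ n)⁻¹ ∫_X f Ω`. -/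
def average (ω₀ : ChartForm n X) (f : X → ℝ) (Ω : TopForm n X) : ℝ :=
  (integral (fun _ => 1) (wedgePow n ω₀ ω₀))⁻¹ * integral f Ω

/-- `h` is the function `h_ω₀`: smooth, `Ric ω₀ = ω₀ + i∂∂̄h` and `∫_X (exp h - 1) ω₀ ^ n = 0`. -/
structure IsRicciPotential (ω₀ : ChartForm n X) (h : X → ℝ) : Prop where
  smooth : ContMDiff 𝓘(ℝ, Fin n → ℂ) 𝓘(ℝ, ℝ) ∞ h
  ricci_eq : FormEq (ricci ω₀) (ω₀ + ddbar h)
  normalized : integral (fun x => Real.exp (h x) - 1) (wedgePow n ω₀ ω₀) = 0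

/-- The K-energy `ν_ω₀(φ)` of the class `2π c₁(X)` (`h` is the function `h_ω₀`). -/
def kEnergy (ω₀ : ChartForm n X) (h φ : X → ℝ) : ℝ :=
  average ω₀ (fun x => logRatio ω₀ (ω₀ + ddbar φ) x + φ x - h x)
      (wedgePow n (ω₀ + ddbar φ) (ω₀ + ddbar φ))
    - 1 / ((n : ℝ) + 1) * ∑ k ∈ Finset.range (n + 1), average ω₀ φ (wedgePow k ω₀ (ω₀ + ddbar φ))
    + average ω₀ h (wedgePow n ω₀ ω₀)

/-- The coefficients `b₀ = b₁ = n - 1` and `b_k = -2` for `k ≥ 2`. -/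
def bCoeff (n k : ℕ) : ℝ := if k ≤ 1 then (n : ℝ) - 1 else -2

/-- The Chen–Tian energy `E_{1,ω₀}(φ)` of the class `2π c₁(X)` (`h` is the function `h_ω₀`). -/
def chenTianE1 (ω₀ : ChartForm n X) (h φ : X → ℝ) : ℝ :=
  average ω₀ (fun x => logRatio ω₀ (ω₀ + ddbar φ) x - h x)
      (wedgePow 1 (ricci (ω₀ + ddbar φ) + ω₀) (ω₀ + ddbar φ))
    + ∑ k ∈ Finset.range (n + 1),
        bCoeff n k / ((n : ℝ) + 1) * average ω₀ φ (wedgePow k ω₀ (ω₀ + ddbar φ))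
    + average ω₀ h (wedgePow 1 (ricci ω₀ + ω₀) ω₀)

end Manifold

end KahlerRicci

end

noncomputable section

namespace KahlerRicci

open scoped Manifold ContDiff ComplexOrder Matrix

open MeasureTheory

/-! ### Exterior products of `(1,1)`-forms as determinants -/

section Wedge

variable {n : ℕ} {X : Type*} [TopologicalSpace X]

/-! The relation is an identity between energies, valid for every Kähler potential. Put `η = ω₀ +
i∂∂̄φ` and `u = log (η ^ n / ω₀ ^ n) + φ - h`. Then `Ric η = η - i∂∂̄u` (`ricci_add_ddbar`), so the
first integrand of `E₁` is `(u - φ)(2η - i∂∂̄u - i∂∂̄φ) ∧ η ^ (n - 1)`. Since `i∂∂̄` is symmetric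
against `η ^ (n - 1)`, the mixed terms in `u` and `φ` cancel. The weights `b_k` add `∫ φ η ^ n + ∫ φ
ω₀ ∧ η ^ (n - 1)`, which kills the remaining `φ` terms because `ω₀ = η - i∂∂̄φ`, and they add `-2 /
(n + 1)` times the sum that enters the K-energy (`sum_bCoeff`). What is left is `2ν`, the term `-∫ u
i∂∂̄u ∧ η ^ (n - 1)`, which is the gradient integral and nonnegative, and a constant
(`chenTianE1_eq`). Along the flow of potentials, `u` is the time derivative of `φ`. The analytic
input is Stokes' theorem in the form `integral_traceForm_ddbar`. In a chart, wedging with `g ^ (n -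
1)` is pairing with the adjugate of `g`, whose divergence vanishes when `g` is closed
(`sum_dz_adjugate`). The charts are glued by the partition of unity, whose gradients sum to zero. -/

theorem wedge_eq_sum_det (α : Fin n → ChartForm n X) (e : OpenPartialHomeomorph X (Fin n → ℂ))
    (y : Fin n → ℂ) :
    wedge α e y = 2 ^ n * (∑ τ : Equiv.Perm (Fin n),
      (Matrix.of fun a m => α (τ.symm m) e y a m).det).re := by
  unfold wedge
  congr 2
  -- For fixed `τ`, reindexing `σ` by `σ * τ⁻¹` absorbs the sign of `τ` and turns the inner sum into
  -- one determinant, with columns drawn from the different forms.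
  rw [Finset.sum_comm]
  refine Finset.sum_congr rfl fun τ _ => ?_
  rw [Matrix.det_apply']
  refine Fintype.sum_equiv (Equiv.mulRight τ⁻¹) _ _ fun σ => ?_
  have h1 : ∏ i, α i e y (σ i) (τ i) =
      ∏ m, α (τ.symm m) e y (σ (τ.symm m)) m := by
    rw [← Equiv.prod_comp τ fun m => α (τ.symm m) e y (σ (τ.symm m)) m]
    refine Finset.prod_congr rfl fun i _ => ?_
    rw [Equiv.symm_apply_apply]
  have h2 : ((Equiv.Perm.sign τ⁻¹ : ℤ) : ℂ) = ((Equiv.Perm.sign τ : ℤ) : ℂ) := by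
    rw [Equiv.Perm.sign_inv]
  simp only [Equiv.coe_mulRight, map_mul, Units.val_mul, Int.cast_mul, h1, h2, Matrix.of_apply,
    Equiv.Perm.mul_apply]
  rfl

theorem wedge_const (β : ChartForm n X) (e : OpenPartialHomeomorph X (Fin n → ℂ))
    (y : Fin n → ℂ) :
    wedge (fun _ => β) e y = 2 ^ n * n.factorial * (β e y).det.re := by
  rw [wedge_eq_sum_det]
  have : (Matrix.of fun a m => β e y a m) = β e y := rfl
  simp only [this, Finset.sum_const, Finset.card_univ, Fintype.card_perm, Fintype.card_fin,
    nsmul_eq_mul, Complex.mul_re, Complex.natCast_re, Complex.natCast_im, zero_mul, sub_zero]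
  ring

theorem wedgePow_self (k : ℕ) (β : ChartForm n X) : wedgePow k β β = wedge fun _ => β := by
  simp [wedgePow]

theorem wedgePow_zero (α β : ChartForm n X) : wedgePow 0 α β = wedgePow n β β := by
  simp [wedgePow]

theorem wedgePow_self_apply (k : ℕ) (β : ChartForm n X)
    (e : OpenPartialHomeomorph X (Fin n → ℂ)) (y : Fin n → ℂ) :
    wedgePow k β β e y = 2 ^ n * n.factorial * (β e y).det.re := by
  rw [wedgePow_self, wedge_const]

/-- Cramer's rule: the `j`-th term is the `j`-th diagonal entry of `B.adjugate * A`. -/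
theorem sum_det_updateCol {m : ℕ} (A B : Matrix (Fin m) (Fin m) ℂ) :
    ∑ j, (B.updateCol j fun a => A a j).det = (B.adjugate * A).trace := by
  simp only [Matrix.trace, Matrix.diag_apply, Matrix.mul_apply]
  refine Finset.sum_congr rfl fun j _ => ?_
  rw [← Matrix.cramer_apply, Matrix.cramer_eq_adjugate_mulVec]
  rfl

/-- Exactly one column of each determinant, the one at `τ 0`, comes from `α`. Each value of `τ 0` is
taken by `(n - 1)!` permutations, and `sum_det_updateCol` sums over these values. -/
theorem wedgePow_one_apply (hn : 1 ≤ n) (α β : ChartForm n X)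
    (e : OpenPartialHomeomorph X (Fin n → ℂ)) (y : Fin n → ℂ) :
    wedgePow 1 α β e y =
      2 ^ n * (n - 1).factorial * ((β e y).adjugate * α e y).trace.re := by
  obtain ⟨m, rfl⟩ : ∃ m, n = m + 1 := ⟨n - 1, by omega⟩
  have h1 : ∀ τ : Equiv.Perm (Fin (m + 1)),
      (Matrix.of fun a j => (if ((τ.symm j : Fin (m + 1)) : ℕ) < 1 then α else β) e y a j) =
        (β e y).updateCol (τ 0) fun a => α e y a (τ 0) := by
    intro τ
    ext a j
    rw [Matrix.updateCol_apply, Matrix.of_apply]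
    by_cases h : j = τ 0
    · subst h; simp
    · have : (τ.symm j : Fin (m + 1)) ≠ 0 := fun h' => h (by rw [← h']; simp)
      have h3 : ¬ ((τ.symm j : Fin (m + 1)) : ℕ) < 1 := by
        intro h4
        exact this (Fin.ext (by simpa using h4))
      rw [if_neg h3, if_neg h]
  rw [wedgePow, wedge_eq_sum_det]
  simp only [h1]
  rw [← Equiv.sum_comp Equiv.Perm.decomposeFin.symm, Fintype.sum_prod_type]
  simp only [Equiv.Perm.decomposeFin_symm_apply_zero, Finset.sum_const, Finset.card_univ,
    Fintype.card_perm, Fintype.card_fin, nsmul_eq_mul]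
  rw [← Finset.mul_sum, sum_det_updateCol, Nat.add_sub_cancel, Complex.mul_re, Complex.natCast_re,
    Complex.natCast_im, zero_mul, sub_zero]
  ring

end Wedge

/-! ### Wirtinger derivatives -/

section Wirtinger

variable {n : ℕ}

/-- The `(1,0)`-part of a real linear functional, evaluated at `∂/∂z_j`. -/
def holPart (j : Fin n) : ((Fin n → ℂ) →L[ℝ] ℂ) →ₗ[ℂ] ℂ where
  toFun A := (1 / 2 : ℂ) * (A (Pi.single j 1) - Complex.I * A (Pi.single j Complex.I))
  map_add' A B := by simp; ring
  map_smul' c A := by simp; ring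

theorem dz_eq (j : Fin n) (f : (Fin n → ℂ) → ℂ) (y : Fin n → ℂ) :
    dz j f y = holPart j (fderiv ℝ f y) := rfl

theorem dz_mul (j : Fin n) {f g : (Fin n → ℂ) → ℂ} {y : Fin n → ℂ}
    (hf : DifferentiableAt ℝ f y) (hg : DifferentiableAt ℝ g y) :
    dz j (fun z => f z * g z) y = dz j f y * g y + f y * dz j g y := by
  rw [dz_eq, fderiv_fun_mul hf hg, map_add, map_smul, map_smul, dz_eq, dz_eq]
  simp; ring

theorem dz_add (j : Fin n) {f g : (Fin n → ℂ) → ℂ} {y : Fin n → ℂ}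
    (hf : DifferentiableAt ℝ f y) (hg : DifferentiableAt ℝ g y) :
    dz j (fun z => f z + g z) y = dz j f y + dz j g y := by
  rw [dz_eq, fderiv_fun_add hf hg, map_add, dz_eq, dz_eq]

theorem dz_sum {ι : Type*} (s : Finset ι) (j : Fin n) {f : ι → (Fin n → ℂ) → ℂ} {y : Fin n → ℂ}
    (hf : ∀ i ∈ s, DifferentiableAt ℝ (f i) y) :
    dz j (fun z => ∑ i ∈ s, f i z) y = ∑ i ∈ s, dz j (f i) y := by
  rw [dz_eq, fderiv_fun_sum hf, map_sum]
  rfl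

theorem dz_const (j : Fin n) (c : ℂ) (y : Fin n → ℂ) : dz j (fun _ => c) y = 0 := by
  simp [dz]

theorem dz_congr (j : Fin n) {f g : (Fin n → ℂ) → ℂ} {y : Fin n → ℂ}
    (h : f =ᶠ[nhds y] g) : dz j f y = dz j g y := by
  rw [dz_eq, h.fderiv_eq, dz_eq]

theorem dzbar_congr (j : Fin n) {f g : (Fin n → ℂ) → ℂ} {y : Fin n → ℂ}
    (h : f =ᶠ[nhds y] g) : dzbar j f y = dzbar j g y := by
  rw [dzbar, h.fderiv_eq, dzbar]

theorem dzbar_ofReal (j : Fin n) {f : (Fin n → ℂ) → ℝ} {y : Fin n → ℂ}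
    (hf : DifferentiableAt ℝ f y) :
    dzbar j (fun z => (f z : ℂ)) y = star (dz j (fun z => (f z : ℂ)) y) := by
  have h : fderiv ℝ (fun z => (f z : ℂ)) y = Complex.ofRealCLM.comp (fderiv ℝ f y) :=
    (Complex.ofRealCLM.hasFDerivAt.comp y hf.hasFDerivAt).fderiv
  simp [dz, dzbar, h]

/-- The left side is the complex-linear part of `A` at `v`, hence is determined by its values on the
standard basis. -/
theorem holPart_sum (A : (Fin n → ℂ) →L[ℝ] ℂ) (v : Fin n → ℂ) :
    (1 / 2 : ℂ) * (A v - Complex.I * A (Complex.I • v)) = ∑ l, v l * holPart l A := by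
  have key : ∀ w : Fin n → ℂ, A w = ∑ l, ((w l).re * A (Pi.single l 1) +
      (w l).im * A (Pi.single l Complex.I)) := by
    intro w
    conv_lhs => rw [← Finset.univ_sum_single w, map_sum]
    refine Finset.sum_congr rfl fun l _ => ?_
    have h : (Pi.single l (w l) : Fin n → ℂ) = (w l).re • (Pi.single l 1 : Fin n → ℂ) +
        (w l).im • (Pi.single l Complex.I : Fin n → ℂ) := by
      rw [← Pi.single_smul, ← Pi.single_smul, ← Pi.single_add]
      congr 1
      simp [Complex.re_add_im]
    rw [h, map_add, map_smul, map_smul, Complex.real_smul, Complex.real_smul]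
  rw [key v, key (Complex.I • v), Finset.mul_sum, ← Finset.sum_sub_distrib, Finset.mul_sum]
  refine Finset.sum_congr rfl fun l _ => ?_
  have hv : v l = (v l).re + (v l).im * Complex.I := (Complex.re_add_im _).symm
  conv_rhs => rw [hv]
  simp only [holPart, LinearMap.coe_mk, AddHom.coe_mk, Pi.smul_apply, smul_eq_mul,
    Complex.mul_re, Complex.mul_im, Complex.I_re, Complex.I_im]
  push_cast
  linear_combination ((v l).im * A (Pi.single l Complex.I) * (1/2)) * Complex.I_mul_I

/-- The Wirtinger chain rule for a holomorphic change of variables. -/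
theorem dz_comp (j : Fin n) {f : (Fin n → ℂ) → ℂ} {Φ : (Fin n → ℂ) → (Fin n → ℂ)}
    {y : Fin n → ℂ} (hf : DifferentiableAt ℝ f (Φ y)) (hΦ : DifferentiableAt ℂ Φ y) :
    dz j (fun z => f (Φ z)) y = ∑ l, fderiv ℂ Φ y (Pi.single j 1) l * dz l f (Φ y) := by
  have h : fderiv ℝ (fun z => f (Φ z)) y =
      (fderiv ℝ f (Φ y)).comp ((fderiv ℂ Φ y).restrictScalars ℝ) :=
    (hf.hasFDerivAt.comp y (hΦ.hasFDerivAt.restrictScalars ℝ)).fderiv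
  have h2 : (Pi.single j Complex.I : Fin n → ℂ) = Complex.I • Pi.single j (1 : ℂ) := by
    rw [← Pi.single_smul]; simp
  change _ = ∑ l, _ * holPart l (fderiv ℝ f (Φ y))
  rw [← holPart_sum, dz, h]
  simp only [ContinuousLinearMap.comp_apply, ContinuousLinearMap.coe_restrictScalars', h2, map_smul]

/-- Leibniz rule in the rows. Transposing makes each product in the permutation expansion run over
rows. -/
theorem dz_det (j : Fin n) {m : ℕ} {M : (Fin n → ℂ) → Matrix (Fin m) (Fin m) ℂ} {y : Fin n → ℂ}
    (hM : ∀ a b, DifferentiableAt ℝ (fun z => M z a b) y) :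
    dz j (fun z => (M z).det) y =
      ∑ l, ((M y).updateRow l fun b => dz j (fun z => M z l b) y).det := by
  have h1 : (fun z => (M z).det) = fun z => ∑ σ : Equiv.Perm (Fin m),
      ((Equiv.Perm.sign σ : ℤ) : ℂ) * ∏ i, M z i (σ i) := by
    funext z
    rw [← Matrix.det_transpose, Matrix.det_apply']
    rfl
  have h2 : ∀ σ : Equiv.Perm (Fin m), DifferentiableAt ℝ (fun z => ∏ i, M z i (σ i)) y :=
    fun σ =>
    (HasFDerivAt.finsetProd fun i _ => (hM i (σ i)).hasFDerivAt).differentiableAt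
  rw [h1, dz_sum _ _ fun σ _ => (h2 σ).const_mul _]
  have h3 : ∀ l, ((M y).updateRow l fun b => dz j (fun z => M z l b) y).det =
      ∑ σ : Equiv.Perm (Fin m), ((Equiv.Perm.sign σ : ℤ) : ℂ) *
        ((∏ i ∈ Finset.univ.erase l, M y i (σ i)) * dz j (fun z => M z l (σ l)) y) := by
    intro l
    rw [← Matrix.det_transpose, Matrix.det_apply']
    refine Finset.sum_congr rfl fun σ _ => ?_
    rw [← Finset.mul_prod_erase _ _ (Finset.mem_univ l)]
    simp only [Matrix.transpose_apply, Matrix.updateRow_self]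
    rw [mul_comm (dz _ _ _)]
    congr 2
    refine Finset.prod_congr rfl fun i hi => ?_
    rw [Matrix.updateRow_ne (Finset.ne_of_mem_erase hi)]
  simp only [h3]
  rw [Finset.sum_comm]
  refine Finset.sum_congr rfl fun σ _ => ?_
  rw [dz_mul _ (differentiableAt_const _) (h2 σ), dz_const, zero_mul, zero_add, dz_eq,
    fderiv_finsetProd fun i _ => hM _ _, map_sum, Finset.mul_sum]
  refine Finset.sum_congr rfl fun l _ => ?_
  rw [map_smul, smul_eq_mul]
  rfl

/-- The adjugate of a closed form is divergence free. -/
theorem sum_dz_adjugate {g : (Fin n → ℂ) → Matrix (Fin n) (Fin n) ℂ} {y : Fin n → ℂ}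
    (hg : ∀ a b, DifferentiableAt ℝ (fun z => g z a b) y)
    (hclosed : ∀ l j k, dz l (fun z => g z j k) y = dz j (fun z => g z l k) y) (k : Fin n) :
    ∑ j, dz j (fun z => (g z).adjugate k j) y = 0 := by
  -- `A j l` comes from differentiating row `l` of the determinant defining `adjugate k j`; the row
  -- `j`, being constant, contributes zero. Exchanging two rows and using closedness makes `A`
  -- antisymmetric, so its total sum vanishes.
  let A : Fin n → Fin n → ℂ := fun j l =>
    (((g y).updateRow j (Pi.single k 1)).updateRow l fun b =>
      if l = j then 0 else dz j (fun z => g z l b) y).det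
  have h1 : ∀ j, dz j (fun z => (g z).adjugate k j) y = ∑ l, A j l := by
    intro j
    simp only [Matrix.adjugate_apply]
    rw [dz_det]
    · refine Finset.sum_congr rfl fun l _ => ?_
      simp only [A]
      congr 2
      funext b
      by_cases h : l = j
      · subst h
        simp only [Matrix.updateRow_self, if_true]
        exact dz_const _ _ _
      · simp only [Matrix.updateRow_ne h, if_neg h]
    · intro a b
      by_cases h : a = j
      · subst h
        simp only [Matrix.updateRow_self]
        exact differentiableAt_const _
      · simp only [Matrix.updateRow_ne h]
        exact hg a b
  have h2 : ∀ j l, A j l = - A l j := by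
    intro j l
    by_cases h : l = j
    · subst h
      have : A l l = 0 := Matrix.det_eq_zero_of_row_eq_zero l (by intro b; simp)
      simp [this]
    · have h3 := Matrix.det_permute (Equiv.swap j l)
        (((g y).updateRow l (Pi.single k 1)).updateRow j fun b =>
          if j = l then 0 else dz l (fun z => g z j b) y)
      rw [Equiv.Perm.sign_swap (Ne.symm h)] at h3
      have h4 : A l j = (((g y).updateRow l (Pi.single k 1)).updateRow j fun b =>
          if j = l then 0 else dz l (fun z => g z j b) y).det := rfl
      rw [h4]
      simp only [Units.val_neg, Units.val_one, Int.cast_neg, Int.cast_one, neg_mul, one_mul] at h3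
      rw [← h3]
      simp only [A]
      congr 1
      ext a b
      simp only [Matrix.submatrix_apply, id, if_neg h, if_neg (Ne.symm h)]
      by_cases ha : a = l
      · subst ha
        simp only [Matrix.updateRow_self, Equiv.swap_apply_right]
        exact hclosed _ _ _
      · by_cases hb : a = j
        · subst hb
          simp [Matrix.updateRow_ne h, Matrix.updateRow_ne (Ne.symm h)]
        · simp [Equiv.swap_apply_of_ne_of_ne hb ha, Matrix.updateRow_ne ha, Matrix.updateRow_ne hb]
  have h5 : ∑ j, ∑ l, A j l = - ∑ j, ∑ l, A j l := by
    conv_lhs => rw [Finset.sum_comm]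
    rw [← Finset.sum_neg_distrib]
    refine Finset.sum_congr rfl fun j _ => ?_
    rw [← Finset.sum_neg_distrib]
    exact Finset.sum_congr rfl fun l _ => h2 l j
  simp only [h1]
  exact self_eq_neg.mp h5

end Wirtinger

/-! ### Integration by parts in a chart -/

section Local

variable {n : ℕ} {U K : Set (Fin n → ℂ)}

theorem contDiffOn_dz (hU : IsOpen U) (j : Fin n) {f : (Fin n → ℂ) → ℂ}
    (hf : ContDiffOn ℝ ∞ f U) : ContDiffOn ℝ ∞ (fun y => dz j f y) U := by
  have h : ContDiffOn ℝ ∞ (fderiv ℝ f) U := hf.fderiv_of_isOpen hU (by simp)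
  exact contDiffOn_const.mul ((h.clm_apply contDiffOn_const).sub
    (contDiffOn_const.mul (h.clm_apply contDiffOn_const)))

theorem contDiffOn_dzbar (hU : IsOpen U) (j : Fin n) {f : (Fin n → ℂ) → ℂ}
    (hf : ContDiffOn ℝ ∞ f U) : ContDiffOn ℝ ∞ (fun y => dzbar j f y) U := by
  have h : ContDiffOn ℝ ∞ (fderiv ℝ f) U := hf.fderiv_of_isOpen hU (by simp)
  exact contDiffOn_const.mul ((h.clm_apply contDiffOn_const).add
    (contDiffOn_const.mul (h.clm_apply contDiffOn_const)))

theorem contDiffOn_ofReal {f : (Fin n → ℂ) → ℝ} (hf : ContDiffOn ℝ ∞ f U) :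
    ContDiffOn ℝ ∞ (fun y => (f y : ℂ)) U :=
  Complex.ofRealCLM.contDiff.comp_contDiffOn hf

theorem contDiffOn_det {m : ℕ} {g : (Fin n → ℂ) → Matrix (Fin m) (Fin m) ℂ}
    (hg : ∀ a b, ContDiffOn ℝ ∞ (fun y => g y a b) U) :
    ContDiffOn ℝ ∞ (fun y => (g y).det) U := by
  simp only [Matrix.det_apply']
  exact ContDiffOn.sum fun σ _ => contDiffOn_const.mul (contDiffOn_prod fun i _ => hg _ _)

theorem contDiffOn_adjugate {m : ℕ} {g : (Fin n → ℂ) → Matrix (Fin m) (Fin m) ℂ}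
    (hg : ∀ a b, ContDiffOn ℝ ∞ (fun y => g y a b) U) (k j : Fin m) :
    ContDiffOn ℝ ∞ (fun y => (g y).adjugate k j) U := by
  simp only [Matrix.adjugate_apply]
  refine contDiffOn_det fun a b => ?_
  by_cases h : a = j
  · subst h
    simp only [Matrix.updateRow_self]
    exact contDiffOn_const
  · simp only [Matrix.updateRow_ne h]
    exact hg a b

theorem integrableOn_of_continuousOn {F : Type*} [NormedAddCommGroup F] (hU : IsOpen U)
    (hK : IsCompact K) (hKU : K ⊆ U)
    {w : (Fin n → ℂ) → F} (hw : ContinuousOn w U) (h0 : ∀ y ∈ U, y ∉ K → w y = 0) :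
    IntegrableOn w U :=
  ((hw.mono hKU).integrableOn_compact hK).of_forall_sdiff_eq_zero hU.measurableSet
    fun y hy => h0 y hy.1 hy.2

theorem fderiv_eq_zero_off {F : Type*} [NormedAddCommGroup F] [NormedSpace ℝ F] (hU : IsOpen U)
    (hK : IsCompact K) {w : (Fin n → ℂ) → F} (h0 : ∀ y ∈ U, y ∉ K → w y = 0)
    {y : Fin n → ℂ} (hy : y ∈ U) (hyK : y ∉ K) : fderiv ℝ w y = 0 := by
  have h : w =ᶠ[nhds y] fun _ => 0 := by
    filter_upwards [hU.mem_nhds hy, hK.isClosed.isOpen_compl.mem_nhds hyK] with z hz hz'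
    exact h0 z hz hz'
  rw [h.fderiv_eq]
  simp

/-- Extended by zero, `w` is `C¹` with compact support on the whole space, where integration by
parts against the constant `1` applies. -/
theorem setIntegral_fderiv_eq_zero (hU : IsOpen U) (hK : IsCompact K) (hKU : K ⊆ U)
    {w : (Fin n → ℂ) → ℂ} (hw : ContDiffOn ℝ 1 w U) (h0 : ∀ y ∈ U, y ∉ K → w y = 0)
    (v : Fin n → ℂ) : ∫ y in U, fderiv ℝ w y v = 0 := by
  classical
  let w' := U.indicator w
  have hw0 : ∀ y, y ∉ K → w' y = 0 := by
    intro y hy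
    by_cases hyU : y ∈ U
    · simp only [w', Set.indicator_of_mem hyU]
      exact h0 y hyU hy
    · simp only [w', Set.indicator_of_notMem hyU]
  have heq : ∀ y ∈ U, w' =ᶠ[nhds y] w := fun y hy => by
    filter_upwards [hU.mem_nhds hy] with z hz
    exact Set.indicator_of_mem hz w
  have hw' : ContDiff ℝ 1 w' := by
    rw [contDiff_iff_contDiffAt]
    intro y
    by_cases hy : y ∈ U
    · exact (hw.contDiffAt (hU.mem_nhds hy)).congr_of_eventuallyEq (heq y hy)
    · have : w' =ᶠ[nhds y] fun _ => 0 := by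
        filter_upwards [hK.isClosed.isOpen_compl.mem_nhds fun h => hy (hKU h)] with z hz
        exact hw0 z hz
      exact contDiffAt_const.congr_of_eventuallyEq this
  have hcs : HasCompactSupport w' := HasCompactSupport.intro hK fun y hy => hw0 y hy
  have hcd : Continuous fun y => fderiv ℝ w' y v :=
    (hw'.continuous_fderiv one_ne_zero).clm_apply continuous_const
  have hcs' : HasCompactSupport fun y => fderiv ℝ w' y v := hcs.fderiv_apply ℝ v
  have h1 : ∫ y in U, fderiv ℝ w y v = ∫ y in U, fderiv ℝ w' y v :=
    setIntegral_congr_fun hU.measurableSet fun y hy => by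
      simp only [(heq y hy).fderiv_eq]
  have h2 : ∫ y in U, fderiv ℝ w' y v = ∫ y, fderiv ℝ w' y v := by
    refine setIntegral_eq_integral_of_forall_compl_eq_zero fun y hy => ?_
    have : w' =ᶠ[nhds y] fun _ => 0 := by
      filter_upwards [hK.isClosed.isOpen_compl.mem_nhds fun h => hy (hKU h)] with z hz
      exact hw0 z hz
    rw [this.fderiv_eq]
    simp
  have h3 := integral_mul_fderiv_eq_neg_fderiv_mul_of_integrable (μ := volume) (𝕜 := ℂ)
    (f := fun _ : Fin n → ℂ => (1 : ℂ)) (g := w') (v := v) (by simp)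
    (by simpa using hcd.integrable_of_hasCompactSupport hcs')
    (by simpa using hw'.continuous.integrable_of_hasCompactSupport hcs)
    (fun x _ => differentiableAt_const _) (fun x _ => hw'.differentiable one_ne_zero x)
  rw [h1, h2]
  simpa using h3

theorem setIntegral_dz_eq_zero (hU : IsOpen U) (hK : IsCompact K) (hKU : K ⊆ U)
    {w : (Fin n → ℂ) → ℂ} (hw : ContDiffOn ℝ ∞ w U) (h0 : ∀ y ∈ U, y ∉ K → w y = 0)
    (j : Fin n) : ∫ y in U, dz j w y = 0 := by
  have hc : ContinuousOn (fderiv ℝ w) U := hw.continuousOn_fderiv_of_isOpen hU (by simp)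
  have hi : ∀ v, IntegrableOn (fun y => fderiv ℝ w y v) U := fun v =>
    integrableOn_of_continuousOn hU hK hKU (hc.clm_apply continuousOn_const)
      fun y hy hyK => by rw [fderiv_eq_zero_off hU hK h0 hy hyK]; rfl
  have hw1 : ContDiffOn ℝ 1 w U := hw.of_le (by exact_mod_cast le_top)
  simp only [dz]
  rw [integral_const_mul, integral_sub (hi _) ((hi _).const_mul _), integral_const_mul,
    setIntegral_fderiv_eq_zero hU hK hKU hw1 h0, setIntegral_fderiv_eq_zero hU hK hKU hw1 h0]
  simp

/-- Divergence theorem for the field `W` below. Only `G` needs compact support, so it can carry the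
cutoff of a partition of unity. -/
theorem setIntegral_mul_trace_adjugate (hU : IsOpen U) (hK : IsCompact K) (hKU : K ⊆ U)
    {g : (Fin n → ℂ) → Matrix (Fin n) (Fin n) ℂ}
    (hg : ∀ a b, ContDiffOn ℝ ∞ (fun y => g y a b) U)
    (hclosed : ∀ y ∈ U, ∀ l j k, dz l (fun z => g z j k) y = dz j (fun z => g z l k) y)
    {f G : (Fin n → ℂ) → ℝ} (hf : ContDiffOn ℝ ∞ f U) (hG : ContDiffOn ℝ ∞ G U)
    (h0 : ∀ y ∈ U, y ∉ K → G y = 0) :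
    ∫ y in U, G y * ((g y).adjugate *
        Matrix.of fun j k => dz j (dzbar k fun z => (f z : ℂ)) y).trace.re =
      - ∫ y in U, (star (fun k => dz k (fun z => (f z : ℂ)) y) ⬝ᵥ
        (g y).adjugate *ᵥ fun j => dz j (fun z => (G z : ℂ)) y).re := by
  have hfc := contDiffOn_ofReal hf
  have hGc := contDiffOn_ofReal hG
  have h0c : ∀ y ∈ U, y ∉ K → (G y : ℂ) = 0 := fun y hy hyK => by simp [h0 y hy hyK]
  have hda : ∀ {w : (Fin n → ℂ) → ℂ}, ContDiffOn ℝ ∞ w U → ∀ y ∈ U, DifferentiableAt ℝ w y :=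
    fun hw y hy => (hw.contDiffAt (hU.mem_nhds hy)).differentiableAt (by simp)
  have hb : ∀ k, ContDiffOn ℝ ∞ (fun y => dzbar k (fun z => (f z : ℂ)) y) U :=
    fun k => contDiffOn_dzbar hU k hfc
  let W : Fin n → (Fin n → ℂ) → ℂ := fun j y =>
    (G y : ℂ) * ∑ k, dzbar k (fun z => (f z : ℂ)) y * (g y).adjugate k j
  have hsum : ∀ j, ContDiffOn ℝ ∞
      (fun y => ∑ k, dzbar k (fun z => (f z : ℂ)) y * (g y).adjugate k j) U :=
    fun j => ContDiffOn.sum fun k _ => (hb k).mul (contDiffOn_adjugate hg k j)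
  have hW : ∀ j, ContDiffOn ℝ ∞ (W j) U := fun j => hGc.mul (hsum j)
  have hW0 : ∀ j, ∀ y ∈ U, y ∉ K → W j y = 0 := fun j y hy hyK => by
    simp [W, h0 y hy hyK]
  -- Of the three terms of the product rule, the one differentiating the adjugate vanishes by
  -- `sum_dz_adjugate`.
  have hdW : ∀ y ∈ U, ∑ j, dz j (W j) y =
      (G y : ℂ) * ((g y).adjugate *
        Matrix.of fun j k => dz j (dzbar k fun z => (f z : ℂ)) y).trace +
      (star (fun k => dz k (fun z => (f z : ℂ)) y) ⬝ᵥ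
        (g y).adjugate *ᵥ fun j => dz j (fun z => (G z : ℂ)) y) := by
    intro y hy
    have hdf : DifferentiableAt ℝ f y := (hf.contDiffAt (hU.mem_nhds hy)).differentiableAt (by simp)
    have e1 : ∀ j, dz j (W j) y =
        dz j (fun z => (G z : ℂ)) y *
          ∑ k, dzbar k (fun z => (f z : ℂ)) y * (g y).adjugate k j +
        (G y : ℂ) * ∑ k, (dz j (dzbar k fun z => (f z : ℂ)) y * (g y).adjugate k j +
          dzbar k (fun z => (f z : ℂ)) y * dz j (fun z => (g z).adjugate k j) y) := by
      intro j
      rw [dz_mul j (hda hGc y hy) (hda (hsum j) y hy), dz_sum _ _ fun k _ =>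
        (hda (hb k) y hy).fun_mul (hda (contDiffOn_adjugate hg k j) y hy)]
      congr 2
      refine Finset.sum_congr rfl fun k _ => ?_
      rw [dz_mul j (hda (hb k) y hy) (hda (contDiffOn_adjugate hg k j) y hy)]
    have e2 : ∑ j, ∑ k, dzbar k (fun z => (f z : ℂ)) y * dz j (fun z => (g z).adjugate k j) y
        = 0 := by
      rw [Finset.sum_comm]
      refine Finset.sum_eq_zero fun k _ => ?_
      rw [← Finset.mul_sum, sum_dz_adjugate (fun a b => hda (hg a b) y hy) (hclosed y hy), mul_zero]
    simp only [e1, Finset.sum_add_distrib, ← Finset.mul_sum, e2, add_zero]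
    rw [add_comm]
    congr 1
    · congr 1
      rw [Finset.sum_comm]
      simp only [Matrix.trace, Matrix.diag_apply, Matrix.mul_apply, Matrix.of_apply]
      refine Finset.sum_congr rfl fun k _ => Finset.sum_congr rfl fun j _ => mul_comm _ _
    · simp only [Matrix.mulVec, dotProduct, Pi.star_apply, Finset.mul_sum]
      rw [Finset.sum_comm]
      refine Finset.sum_congr rfl fun k _ => Finset.sum_congr rfl fun j _ => ?_
      rw [dzbar_ofReal k hdf]
      ring
  have hiW : ∀ j, IntegrableOn (fun y => dz j (W j) y) U := fun j =>
    integrableOn_of_continuousOn hU hK hKU (contDiffOn_dz hU j (hW j)).continuousOn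
      fun y hy hyK => by rw [dz_eq, fderiv_eq_zero_off hU hK (hW0 j) hy hyK, map_zero]
  have hz : ∫ y in U, ∑ j, dz j (W j) y = 0 := by
    rw [integral_finsetSum _ fun j _ => hiW j]
    exact Finset.sum_eq_zero fun j _ => setIntegral_dz_eq_zero hU hK hKU (hW j) (hW0 j) j
  have hc1 : ContinuousOn (fun y => ((g y).adjugate *
      Matrix.of fun j k => dz j (dzbar k fun z => (f z : ℂ)) y).trace) U := by
    simp only [Matrix.trace, Matrix.diag_apply, Matrix.mul_apply, Matrix.of_apply]
    exact continuousOn_finsetSum _ fun k _ => continuousOn_finsetSum _ fun j _ =>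
      (contDiffOn_adjugate hg k j).continuousOn.mul (contDiffOn_dz hU j (hb k)).continuousOn
  have hc2 : ContinuousOn (fun y => star (fun k => dz k (fun z => (f z : ℂ)) y) ⬝ᵥ
      (g y).adjugate *ᵥ fun j => dz j (fun z => (G z : ℂ)) y) U := by
    simp only [Matrix.mulVec, dotProduct, Pi.star_apply]
    exact continuousOn_finsetSum _ fun k _ => (contDiffOn_dz hU k hfc).continuousOn.star.mul
      (continuousOn_finsetSum _ fun j _ => (contDiffOn_adjugate hg k j).continuousOn.mul
        (contDiffOn_dz hU j hGc).continuousOn)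
  have hi1 := integrableOn_of_continuousOn hU hK hKU (hGc.continuousOn.fun_mul hc1)
    fun y hy hyK => by rw [h0c y hy hyK, zero_mul]
  have hi2 := integrableOn_of_continuousOn hU hK hKU hc2 fun y hy hyK => by
    have : (fun j => dz j (fun z => (G z : ℂ)) y) = 0 := by
      funext j
      rw [dz_eq, fderiv_eq_zero_off hU hK h0c hy hyK, map_zero]; rfl
    rw [this, Matrix.mulVec_zero, dotProduct_zero]
  rw [setIntegral_congr_fun hU.measurableSet hdW, integral_add hi1 hi2] at hz
  have hre := congrArg Complex.re hz
  rw [Complex.add_re, Complex.zero_re] at hre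
  have r1 := integral_re (𝕜 := ℂ) hi1
  have r2 := integral_re (𝕜 := ℂ) hi2
  simp only [RCLike.re_to_complex] at r1 r2
  rw [← r1, ← r2] at hre
  simp only [Complex.re_ofReal_mul] at hre
  linarith

end Local

/-! ### Integration by parts on a compact complex manifold -/

section Global

variable {n : ℕ} {X : Type*} [TopologicalSpace X]

/-- The coefficients of `∂f` in a chart. -/
def gradVec (f : X → ℝ) (e : OpenPartialHomeomorph X (Fin n → ℂ)) (y : Fin n → ℂ) : Fin n → ℂ :=
  fun j => dz j (fun z => (f (e.symm z) : ℂ)) y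

/-- Up to a factor, the density of the real part of `i∂f ∧ ∂̄u ∧ g ^ (n - 1)`. -/
def gradPairing (g : ChartForm n X) (f u : X → ℝ) : TopForm n X := fun e y =>
  (star (gradVec u e y) ⬝ᵥ (g e y).adjugate *ᵥ gradVec f e y).re

/-- Up to a factor, the density of `α ∧ g ^ (n - 1)`. -/
def traceForm (g α : ChartForm n X) : TopForm n X := fun e y =>
  ((g e y).adjugate * α e y).trace.re

theorem gradVec_eq_zero {f : X → ℝ} {e : OpenPartialHomeomorph X (Fin n → ℂ)}
    {y : Fin n → ℂ} (hy : y ∈ e.target) (h : e.symm y ∉ tsupport f) : gradVec f e y = 0 := by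
  have h1 : ∀ᶠ z in nhds y, e.symm z ∈ (tsupport f)ᶜ :=
    (e.continuousAt_symm hy).eventually_mem ((isClosed_tsupport f).isOpen_compl.mem_nhds h)
  funext j
  have h2 : (fun z => (f (e.symm z) : ℂ)) =ᶠ[nhds y] fun _ => 0 := by
    filter_upwards [h1] with z hz
    rw [image_eq_zero_of_notMem_tsupport hz, Complex.ofReal_zero]
  rw [gradVec, dz_congr j h2, dz_const]
  rfl

theorem gradPairing_add_left (g : ChartForm n X) {f u : X → ℝ}
    {e : OpenPartialHomeomorph X (Fin n → ℂ)} {y : Fin n → ℂ} {a b : ℝ} {f₁ f₂ : X → ℝ}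
    (h : gradVec f e y = (a : ℂ) • gradVec f₁ e y + (b : ℂ) • gradVec f₂ e y) :
    gradPairing g f u e y = a * gradPairing g f₁ u e y + b * gradPairing g f₂ u e y := by
  simp only [gradPairing, h, Matrix.mulVec_add, Matrix.mulVec_smul, dotProduct_add,
    dotProduct_smul, Complex.add_re, smul_eq_mul, Complex.re_ofReal_mul]

variable [ChartedSpace (Fin n → ℂ) X]

variable (n) in
/-- Smoothness of a real function, read in all charts of the atlas. -/
def IsChartSmooth (f : X → ℝ) : Prop :=
  ∀ e ∈ atlas (Fin n → ℂ) X, ContDiffOn ℝ ∞ (fun y => f (e.symm y)) e.target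

/-- The transformation law of densities under holomorphic changes of coordinates. -/
def IsTopForm (Ω : TopForm n X) : Prop :=
  ∀ e ∈ atlas (Fin n → ℂ) X, ∀ e' ∈ atlas (Fin n → ℂ) X, ∀ x ∈ e.source ∩ e'.source,
    Ω e (e x) = ‖(jacobian e e' (e x)).det‖ ^ 2 * Ω e' (e' x)

/-- Continuity of a top degree form in all charts of the atlas. -/
def IsContinuousForm (Ω : TopForm n X) : Prop :=
  ∀ e ∈ atlas (Fin n → ℂ) X, ContinuousOn (Ω e) e.target

theorem IsChartSmooth.differentiableAt {f : X → ℝ} (hf : IsChartSmooth n f)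
    {e : OpenPartialHomeomorph X (Fin n → ℂ)} (he : e ∈ atlas (Fin n → ℂ) X) {y : Fin n → ℂ}
    (hy : y ∈ e.target) : DifferentiableAt ℝ (fun z => f (e.symm z)) y :=
  ((hf e he).contDiffAt (e.open_target.mem_nhds hy)).differentiableAt (by simp)

theorem IsChartSmooth.differentiableAt_ofReal {f : X → ℝ} (hf : IsChartSmooth n f)
    {e : OpenPartialHomeomorph X (Fin n → ℂ)} (he : e ∈ atlas (Fin n → ℂ) X) {y : Fin n → ℂ}
    (hy : y ∈ e.target) : DifferentiableAt ℝ (fun z => (f (e.symm z) : ℂ)) y :=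
  Complex.ofRealCLM.differentiableAt.comp y (hf.differentiableAt he hy)

theorem IsChartSmooth.mul {f u : X → ℝ} (hf : IsChartSmooth n f) (hu : IsChartSmooth n u) :
    IsChartSmooth n fun x => f x * u x := fun e he => (hf e he).mul (hu e he)

theorem IsChartSmooth.continuousOn_gradVec {f : X → ℝ} (hf : IsChartSmooth n f)
    {e : OpenPartialHomeomorph X (Fin n → ℂ)} (he : e ∈ atlas (Fin n → ℂ) X) (j : Fin n) :
    ContinuousOn (fun y => gradVec f e y j) e.target :=
  (contDiffOn_dz e.open_target j (contDiffOn_ofReal (hf e he))).continuousOn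

theorem gradVec_mul {f u : X → ℝ} (hf : IsChartSmooth n f) (hu : IsChartSmooth n u)
    {e : OpenPartialHomeomorph X (Fin n → ℂ)} (he : e ∈ atlas (Fin n → ℂ) X) {y : Fin n → ℂ}
    (hy : y ∈ e.target) :
    gradVec (fun x => f x * u x) e y =
      (f (e.symm y) : ℂ) • gradVec u e y + (u (e.symm y) : ℂ) • gradVec f e y := by
  funext j
  simp only [gradVec, Complex.ofReal_mul, Pi.add_apply, Pi.smul_apply, smul_eq_mul]
  rw [dz_mul j (hf.differentiableAt_ofReal he hy) (hu.differentiableAt_ofReal he hy)]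
  ring

theorem continuousOn_gradPairing {g : ChartForm n X} (hg : IsHermitianMetric g) {f u : X → ℝ}
    (hf : IsChartSmooth n f) (hu : IsChartSmooth n u) : IsContinuousForm (gradPairing g f u) := by
  intro e he
  change ContinuousOn (fun y => (star (gradVec u e y) ⬝ᵥ
    (g e y).adjugate *ᵥ gradVec f e y).re) e.target
  simp only [Matrix.mulVec, dotProduct, Pi.star_apply]
  exact Complex.continuous_re.comp_continuousOn (continuousOn_finsetSum _ fun k _ =>
    (hu.continuousOn_gradVec he k).star.mul (continuousOn_finsetSum _ fun j _ =>
      (contDiffOn_adjugate (hg.smooth e he) k j).continuousOn.mul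
        (hf.continuousOn_gradVec he j)))

/-- The adjugate of a Hermitian matrix is Hermitian, so exchanging `f` and `u` conjugates the
pairing and preserves its real part. -/
theorem gradPairing_comm {g : ChartForm n X} (hg : IsHermitianMetric g) (f u : X → ℝ)
    {e : OpenPartialHomeomorph X (Fin n → ℂ)} (he : e ∈ atlas (Fin n → ℂ) X) {y : Fin n → ℂ}
    (hy : y ∈ e.target) : gradPairing g f u e y = gradPairing g u f e y := by
  have h := (hg.posDef e he y hy).isHermitian
  have h1 : (g e y).adjugateᴴ = (g e y).adjugate := by
    rw [Matrix.adjugate_conjTranspose, h.eq]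
  have h2 : star (star (gradVec u e y) ⬝ᵥ (g e y).adjugate *ᵥ gradVec f e y) =
      star (gradVec f e y) ⬝ᵥ (g e y).adjugate *ᵥ gradVec u e y := by
    rw [← Matrix.star_dotProduct_star, star_star, Matrix.star_mulVec, h1, dotProduct_comm,
      Matrix.dotProduct_mulVec, dotProduct_comm]
  rw [gradPairing, gradPairing, ← h2]
  simp

/-- For positive definite `g` the adjugate is `det g` times the inverse, both positive. -/
theorem gradPairing_self_nonneg {g : ChartForm n X} (hg : IsHermitianMetric g) (f : X → ℝ)
    {e : OpenPartialHomeomorph X (Fin n → ℂ)} (he : e ∈ atlas (Fin n → ℂ) X) {y : Fin n → ℂ}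
    (hy : y ∈ e.target) : 0 ≤ gradPairing g f f e y := by
  have h := hg.posDef e he y hy
  have hd := h.det_pos
  have h1 : (g e y).adjugate = (g e y).det • (g e y)⁻¹ := by
    rw [Matrix.inv_def, smul_smul, Ring.mul_inverse_cancel _ hd.ne'.isUnit, one_smul]
  have h2 := (h.inv.posSemidef).dotProduct_mulVec_nonneg (gradVec f e y)
  rw [gradPairing, h1, Matrix.smul_mulVec, dotProduct_smul]
  exact (Complex.le_def.mp (mul_nonneg hd.le h2)).1

theorem det_re_pos {g : ChartForm n X} (hg : IsHermitianMetric g)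
    {e : OpenPartialHomeomorph X (Fin n → ℂ)} (he : e ∈ atlas (Fin n → ℂ) X) {y : Fin n → ℂ}
    (hy : y ∈ e.target) : 0 < (g e y).det.re :=
  (Complex.lt_def.mp (hg.posDef e he y hy).det_pos).1

theorem isTopForm_det {g : ChartForm n X} (hg : IsHermitianMetric g) :
    IsTopForm (fun e y => (g e y).det.re : TopForm n X) := by
  intro e he e' he' x hx
  have h : ((jacobian e e' (e x)).map star).det = star (jacobian e e' (e x)).det :=
    (RingHom.map_det (starRingEnd ℂ) _).symm
  simp only
  rw [hg.compatible e he e' he' x hx, Matrix.det_mul, Matrix.det_mul, Matrix.det_transpose, h,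
    mul_right_comm, Complex.star_def, Complex.mul_conj, Complex.re_ofReal_mul,
    Complex.normSq_eq_norm_sq]

theorem isTopForm_mul (ψ : X → ℝ) {Ω : TopForm n X} (hΩ : IsTopForm Ω) :
    IsTopForm (fun e y => ψ (e.symm y) * Ω e y : TopForm n X) := by
  intro e he e' he' x hx
  simp only
  rw [hΩ e he e' he' x hx, e.left_inv hx.1, e'.left_inv hx.2]
  ring

/-! ### Holomorphic changes of coordinates -/

section Transition

variable [IsManifold 𝓘(ℂ, Fin n → ℂ) ω X]

theorem differentiableAt_transition {e e' : OpenPartialHomeomorph X (Fin n → ℂ)}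
    (he : e ∈ atlas (Fin n → ℂ) X) (he' : e' ∈ atlas (Fin n → ℂ) X) {y : Fin n → ℂ}
    (hy : y ∈ e.target) (hy' : e.symm y ∈ e'.source) :
    DifferentiableAt ℂ (fun z => e' (e.symm z)) y := by
  have h := (contDiffGroupoid ω 𝓘(ℂ, Fin n → ℂ)).compatible he he'
  rw [contDiffGroupoid, mem_groupoid_of_pregroupoid] at h
  have h1 : ContDiffOn ℂ ω (e.symm ≫ₕ e') (e.symm ≫ₕ e').source := by
    simpa [contDiffPregroupoid] using h.1
  have h2 : y ∈ (e.symm ≫ₕ e').source := by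
    rw [OpenPartialHomeomorph.trans_source]
    exact ⟨hy, hy'⟩
  exact (h1.contDiffAt ((e.symm ≫ₕ e').open_source.mem_nhds h2)).differentiableAt (by simp)

theorem gradVec_transform {f : X → ℝ} (hf : IsChartSmooth n f)
    {e e' : OpenPartialHomeomorph X (Fin n → ℂ)}
    (he : e ∈ atlas (Fin n → ℂ) X) (he' : e' ∈ atlas (Fin n → ℂ) X) {x : X}
    (hx : x ∈ e.source ∩ e'.source) :
    gradVec f e (e x) = (jacobian e e' (e x))ᵀ *ᵥ gradVec f e' (e' x) := by
  have hy : e x ∈ e.target := e.map_source hx.1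
  have hy' : e.symm (e x) ∈ e'.source := by rw [e.left_inv hx.1]; exact hx.2
  have hev : (fun z => (f (e.symm z) : ℂ)) =ᶠ[nhds (e x)]
      fun z => (fun w => (f (e'.symm w) : ℂ)) (e' (e.symm z)) := by
    filter_upwards [(e.continuousAt_symm hy).eventually_mem (e'.open_source.mem_nhds hy')] with z hz
    rw [e'.left_inv hz]
  have h1 : e' (e.symm (e x)) = e' x := by rw [e.left_inv hx.1]
  funext j
  rw [gradVec, dz_congr j hev, dz_comp j (f := fun w => (f (e'.symm w) : ℂ))
    (by rw [h1]; exact hf.differentiableAt_ofReal he' (e'.map_source hx.2))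
    (differentiableAt_transition he he' hy hy'), h1]
  rfl

/-- Gradients pick up `Jᵀ`, while the adjugate of `Jᵀ * A * J̄` picks up the adjugates of `J̄` and
`Jᵀ`. These cancel against the factors from the gradients and leave `det J` times its conjugate. -/
theorem isTopForm_gradPairing {g : ChartForm n X} (hg : IsHermitianMetric g) {f u : X → ℝ}
    (hf : IsChartSmooth n f) (hu : IsChartSmooth n u) : IsTopForm (gradPairing g f u) := by
  intro e he e' he' x hx
  simp only [gradPairing]
  rw [gradVec_transform hf he he' hx, gradVec_transform hu he he' hx,
    hg.compatible e he e' he' x hx]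
  set J := jacobian e e' (e x)
  set A := g e' (e' x)
  have h1 : (Jᵀ * A * J.map star).adjugate =
      (J.map star).adjugate * (A.adjugate * Jᵀ.adjugate) := by
    rw [Matrix.adjugate_mul_distrib, Matrix.adjugate_mul_distrib]
  have h2 : (Jᵀ)ᴴ = J.map star := by rw [Matrix.conjTranspose, Matrix.transpose_transpose]
  have h3 : (J.map star).det = star J.det := (RingHom.map_det (starRingEnd ℂ) _).symm
  have h4 : J.map star * ((J.map star).adjugate * (A.adjugate * Jᵀ.adjugate)) * Jᵀ =
      (star J.det * J.det) • A.adjugate := by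
    rw [← Matrix.mul_assoc, Matrix.mul_adjugate, Matrix.mul_assoc, Matrix.mul_assoc, Matrix.adjugate_mul, h3,
      Matrix.det_transpose, Matrix.smul_mul, Matrix.one_mul, Matrix.mul_smul, Matrix.mul_one,
      smul_smul]
  rw [h1, Matrix.star_mulVec, h2, ← Matrix.dotProduct_mulVec, Matrix.mulVec_mulVec,
    Matrix.mulVec_mulVec, h4, Matrix.smul_mulVec,
    dotProduct_smul, smul_eq_mul, Complex.star_def, mul_comm _ J.det, Complex.mul_conj,
    Complex.re_ofReal_mul, Complex.normSq_eq_norm_sq]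

/-- The real determinant of a complex-linear map is the norm from `ℂ` to `ℝ` of its complex
determinant. This matches `IsTopForm` with the change of variables for Lebesgue measure. -/
theorem det_restrictScalars_fderiv (A : (Fin n → ℂ) →L[ℂ] (Fin n → ℂ)) :
    (A.restrictScalars ℝ).det =
      ‖(Matrix.of fun j k => A (Pi.single k 1) j : Matrix (Fin n) (Fin n) ℂ).det‖ ^ 2 := by
  have h1 : (Matrix.of fun j k => A (Pi.single k 1) j : Matrix (Fin n) (Fin n) ℂ) =
      LinearMap.toMatrix' (A : (Fin n → ℂ) →ₗ[ℂ] (Fin n → ℂ)) := by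
    ext j k
    simp [LinearMap.toMatrix'_apply]
  rw [h1, LinearMap.det_toMatrix', ← Complex.normSq_eq_norm_sq, ← Algebra.norm_complex_apply,
    ← LinearMap.det_restrictScalars]
  rfl

/-- The integral of a density supported in the overlap of two charts can be computed in either. -/
theorem setIntegral_eq_of_isTopForm {Ω : TopForm n X} (hΩ : IsTopForm Ω)
    {e e' : OpenPartialHomeomorph X (Fin n → ℂ)}
    (he : e ∈ atlas (Fin n → ℂ) X) (he' : e' ∈ atlas (Fin n → ℂ) X)
    (h : ∀ y ∈ e.target, e.symm y ∉ e'.source → Ω e y = 0)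
    (h' : ∀ y ∈ e'.target, e'.symm y ∉ e.source → Ω e' y = 0) :
    ∫ y in e.target, Ω e y = ∫ y in e'.target, Ω e' y := by
  set A := (e.symm ≫ₕ e').source with hA
  have hAo : IsOpen A := (e.symm ≫ₕ e').open_source
  have hAmem : ∀ y, y ∈ A ↔ y ∈ e.target ∧ e.symm y ∈ e'.source := fun y => by
    rw [hA, OpenPartialHomeomorph.trans_source]; rfl
  have himg : (fun z => e' (e.symm z)) '' A = (e.symm ≫ₕ e').target :=
    (e.symm ≫ₕ e').image_source_eq_target
  have hBmem : ∀ y, y ∈ (e.symm ≫ₕ e').target ↔ y ∈ e'.target ∧ e'.symm y ∈ e.source := fun y => by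
    rw [OpenPartialHomeomorph.trans_target]; rfl
  have e1 : ∫ y in e.target, Ω e y = ∫ y in A, Ω e y :=
    setIntegral_eq_of_subset_of_forall_sdiff_eq_zero e.open_target.measurableSet
      (fun y hy => ((hAmem y).1 hy).1)
      fun y hy => h y hy.1 fun hy' => hy.2 ((hAmem y).2 ⟨hy.1, hy'⟩)
  have e2 : ∫ y in e'.target, Ω e' y = ∫ y in (e.symm ≫ₕ e').target, Ω e' y :=
    setIntegral_eq_of_subset_of_forall_sdiff_eq_zero e'.open_target.measurableSet
      (fun y hy => ((hBmem y).1 hy).1)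
      fun y hy => h' y hy.1 fun hy' => hy.2 ((hBmem y).2 ⟨hy.1, hy'⟩)
  rw [e1, e2, ← himg, integral_image_eq_integral_abs_det_fderiv_smul volume hAo.measurableSet
    (f' := fun y => (fderiv ℂ (fun z => e' (e.symm z)) y).restrictScalars ℝ)
    (fun y hy => ((differentiableAt_transition he he' ((hAmem y).1 hy).1
      ((hAmem y).1 hy).2).hasFDerivAt.restrictScalars ℝ).hasFDerivWithinAt)
    (e.symm ≫ₕ e').injOn]
  refine setIntegral_congr_fun hAo.measurableSet fun y hy => ?_
  obtain ⟨hy1, hy2⟩ := (hAmem y).1 hy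
  have h3 := hΩ e he e' he' (e.symm y) ⟨e.map_target hy1, hy2⟩
  rw [e.right_inv hy1] at h3
  rw [h3, det_restrictScalars_fderiv, abs_of_nonneg (sq_nonneg _)]
  rfl

end Transition

end Global

/-! ### Integrals over the manifold and global integration by parts -/

section Integral

variable {n : ℕ} {X : Type*} [TopologicalSpace X] [ChartedSpace (Fin n → ℂ) X]
  [IsManifold 𝓘(ℂ, Fin n → ℂ) ω X]

theorem isChartSmooth_of_contMDiff {f : X → ℝ}
    (hf : ContMDiff 𝓘(ℝ, Fin n → ℂ) 𝓘(ℝ, ℝ) ∞ f) : IsChartSmooth n f := by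
  intro e he
  have : IsManifold 𝓘(ℝ, Fin n → ℂ) ∞ X := isManifold_real
  have h := contMDiffOn_symm_of_mem_maximalAtlas (I := 𝓘(ℝ, Fin n → ℂ)) (n := ∞)
    (IsManifold.subset_maximalAtlas he)
  exact contMDiffOn_iff_contDiffOn.mp (hf.comp_contMDiffOn h)

variable [T2Space X] [CompactSpace X]

/-- A locally finite family on a compact space has finitely many nonzero members, so one finite
index set serves every `finsum` in `integral`. -/
theorem exists_finset_partition : ∃ s : Finset X,
    (∀ i ∉ s, ∀ x, partition n X i x = 0) ∧ ∀ x, ∑ i ∈ s, partition n X i x = 1 := by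
  have hfin := (partition n X).locallyFinite.finite_nonempty_of_compact
  have h0 : ∀ i ∉ hfin.toFinset, ∀ x, partition n X i x = 0 := by
    intro i hi x
    by_contra h
    exact hi (hfin.mem_toFinset.mpr ⟨x, h⟩)
  refine ⟨hfin.toFinset, h0, fun x => ?_⟩
  rw [← (partition n X).sum_eq_one (Set.mem_univ x)]
  refine (finsum_eq_sum_of_support_subset _ fun i hi => ?_).symm
  by_contra h
  exact hi (h0 i h x)

theorem integral_eq_sum {s : Finset X} (hs : ∀ i ∉ s, ∀ x, partition n X i x = 0)
    (f : X → ℝ) (Ω : TopForm n X) :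
    integral f Ω = ∑ i ∈ s, ∫ y in (chartAt (Fin n → ℂ) i).target,
      partition n X i ((chartAt (Fin n → ℂ) i).symm y) * f ((chartAt (Fin n → ℂ) i).symm y) *
        Ω (chartAt (Fin n → ℂ) i) y := by
  refine finsum_eq_sum_of_support_subset _ fun i hi => ?_
  by_contra h
  exact hi (by simp [hs i h])

theorem tsupport_partition_subset (i : X) :
    tsupport (partition n X i) ⊆ (chartAt (Fin n → ℂ) i).source :=
  (exists_partition n X).choose_spec i

theorem isChartSmooth_partition (i : X) : IsChartSmooth n (partition n X i) :=
  isChartSmooth_of_contMDiff (partition n X i).contMDiff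

/-- The support of the `i`-th function of the partition of unity, in the chart at `i`. -/
def chartSupport (i : X) : Set (Fin n → ℂ) :=
  chartAt (Fin n → ℂ) i '' tsupport (partition n X i)

theorem isCompact_chartSupport (i : X) : IsCompact (chartSupport (n := n) i) :=
  (isClosed_tsupport _).isCompact.image_of_continuousOn
    ((chartAt (Fin n → ℂ) i).continuousOn.mono (tsupport_partition_subset i))

theorem chartSupport_subset (i : X) :
    chartSupport (n := n) i ⊆ (chartAt (Fin n → ℂ) i).target := by
  rintro _ ⟨x, hx, rfl⟩
  exact (chartAt (Fin n → ℂ) i).map_source (tsupport_partition_subset i hx)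

theorem notMem_tsupport {i : X} {y : Fin n → ℂ} (hy : y ∈ (chartAt (Fin n → ℂ) i).target)
    (h : y ∉ chartSupport (n := n) i) :
    (chartAt (Fin n → ℂ) i).symm y ∉ tsupport (partition n X i) := fun h' =>
  h ⟨_, h', (chartAt (Fin n → ℂ) i).right_inv hy⟩

theorem partition_eq_zero {i : X} {y : Fin n → ℂ} (hy : y ∈ (chartAt (Fin n → ℂ) i).target)
    (h : y ∉ chartSupport (n := n) i) :
    partition n X i ((chartAt (Fin n → ℂ) i).symm y) = 0 :=
  image_eq_zero_of_notMem_tsupport (notMem_tsupport hy h)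

theorem integrableOn_partition_mul (i : X) {w : (Fin n → ℂ) → ℝ}
    (hw : ContinuousOn w (chartAt (Fin n → ℂ) i).target) :
    IntegrableOn (fun y => partition n X i ((chartAt (Fin n → ℂ) i).symm y) * w y)
      (chartAt (Fin n → ℂ) i).target :=
  integrableOn_of_continuousOn (chartAt (Fin n → ℂ) i).open_target (isCompact_chartSupport i)
    (chartSupport_subset i)
    ((isChartSmooth_partition i _ (chart_mem_atlas _ i)).continuousOn.fun_mul hw)
    fun y hy h => by rw [partition_eq_zero hy h, zero_mul]

theorem integral_const_mul_of_eq {f f' : X → ℝ} {Ω Ω' : TopForm n X} (c : ℝ)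
    (h : ∀ e ∈ atlas (Fin n → ℂ) X, ∀ y ∈ e.target,
      f (e.symm y) * Ω e y = c * (f' (e.symm y) * Ω' e y)) :
    integral f Ω = c * integral f' Ω' := by
  obtain ⟨s, hs, -⟩ := exists_finset_partition (n := n) (X := X)
  rw [integral_eq_sum hs, integral_eq_sum hs, Finset.mul_sum]
  refine Finset.sum_congr rfl fun i _ => ?_
  rw [← integral_const_mul]
  refine setIntegral_congr_fun (chartAt (Fin n → ℂ) i).open_target.measurableSet fun y hy => ?_
  have := h _ (chart_mem_atlas _ i) y hy
  simp only [mul_assoc]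
  rw [this]
  ring

theorem integral_congr {f f' : X → ℝ} {Ω Ω' : TopForm n X}
    (h : ∀ e ∈ atlas (Fin n → ℂ) X, ∀ y ∈ e.target,
      f (e.symm y) * Ω e y = f' (e.symm y) * Ω' e y) : integral f Ω = integral f' Ω' := by
  rw [integral_const_mul_of_eq 1 (by simpa using h), one_mul]

/-- Linearity of the integral, in a form that expands a whole integrand at once. Smoothness and
continuity supply integrability, thanks to the compact supports of the partition. -/
theorem integral_eq_sum_mul {m : ℕ} {f : X → ℝ} {Ω : TopForm n X} (c : Fin m → ℝ)
    (F : Fin m → X → ℝ) (Ψ : Fin m → TopForm n X)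
    (h : ∀ e ∈ atlas (Fin n → ℂ) X, ∀ y ∈ e.target,
      f (e.symm y) * Ω e y = ∑ k, c k * (F k (e.symm y) * Ψ k e y))
    (hF : ∀ k, IsChartSmooth n (F k)) (hΨ : ∀ k, IsContinuousForm (Ψ k)) :
    integral f Ω = ∑ k, c k * integral (F k) (Ψ k) := by
  obtain ⟨s, hs, -⟩ := exists_finset_partition (n := n) (X := X)
  simp only [integral_eq_sum hs, Finset.mul_sum]
  rw [Finset.sum_comm]
  refine Finset.sum_congr rfl fun i _ => ?_
  have he := chart_mem_atlas (Fin n → ℂ) i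
  simp only [mul_assoc, ← integral_const_mul]
  rw [← integral_finsetSum _ fun k _ => (integrableOn_partition_mul i
    ((hF k _ he).continuousOn.fun_mul (hΨ k _ he))).const_mul (c k)]
  refine setIntegral_congr_fun (chartAt (Fin n → ℂ) i).open_target.measurableSet fun y hy => ?_
  have := h _ he y hy
  simp only [this, Finset.mul_sum]
  exact Finset.sum_congr rfl fun k _ => by ring

theorem integral_nonneg {f : X → ℝ} {Ω : TopForm n X}
    (h : ∀ e ∈ atlas (Fin n → ℂ) X, ∀ y ∈ e.target, 0 ≤ f (e.symm y) * Ω e y) :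
    0 ≤ integral f Ω := by
  obtain ⟨s, hs, -⟩ := exists_finset_partition (n := n) (X := X)
  rw [integral_eq_sum hs]
  refine Finset.sum_nonneg fun i _ => setIntegral_nonneg
    (chartAt (Fin n → ℂ) i).open_target.measurableSet fun y hy => ?_
  rw [mul_assoc]
  exact mul_nonneg ((partition n X).nonneg i _) (h _ (chart_mem_atlas _ i) y hy)

/-- The contributions of the derivatives of the partition of unity cancel. -/
theorem sum_setIntegral_gradPairing_partition {g : ChartForm n X} (hg : IsHermitianMetric g)
    {f u : X → ℝ} (hf : IsChartSmooth n f) (hu : IsChartSmooth n u) {s : Finset X}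
    (hs : ∀ x, ∑ i ∈ s, partition n X i x = 1) :
    ∑ i ∈ s, ∫ y in (chartAt (Fin n → ℂ) i).target, f ((chartAt (Fin n → ℂ) i).symm y) *
      gradPairing g (partition n X i) u (chartAt (Fin n → ℂ) i) y = 0 := by
  have hmem := fun i : X => chart_mem_atlas (Fin n → ℂ) i
  have hcont : ∀ i j : X, ContinuousOn (fun y => f ((chartAt (Fin n → ℂ) j).symm y) *
      gradPairing g (partition n X i) u (chartAt (Fin n → ℂ) j) y)
        (chartAt (Fin n → ℂ) j).target := fun i j =>
    (hf _ (hmem j)).continuousOn.fun_mul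
      (continuousOn_gradPairing hg (isChartSmooth_partition i) hu _ (hmem j))
  have hzero : ∀ i : X, ∀ e : OpenPartialHomeomorph X (Fin n → ℂ), ∀ y ∈ e.target,
      e.symm y ∉ tsupport (partition n X i) → gradPairing g (partition n X i) u e y = 0 := by
    intro i e y hy h
    rw [gradPairing, gradVec_eq_zero hy h]
    simp
  -- Insert `1 = ∑ j, ρ_j` and move the `(i, j)` term from chart `i` to chart `j`, which is allowed
  -- because its support lies in both.
  have h1 : ∀ i ∈ s, ∫ y in (chartAt (Fin n → ℂ) i).target,
      f ((chartAt (Fin n → ℂ) i).symm y) *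
        gradPairing g (partition n X i) u (chartAt (Fin n → ℂ) i) y =
      ∑ j ∈ s, ∫ y in (chartAt (Fin n → ℂ) j).target,
        partition n X j ((chartAt (Fin n → ℂ) j).symm y) *
          (f ((chartAt (Fin n → ℂ) j).symm y) *
            gradPairing g (partition n X i) u (chartAt (Fin n → ℂ) j) y) := by
    intro i _
    have h2 : ∀ j ∈ s, ∫ y in (chartAt (Fin n → ℂ) j).target,
        partition n X j ((chartAt (Fin n → ℂ) j).symm y) *
          (f ((chartAt (Fin n → ℂ) j).symm y) *
            gradPairing g (partition n X i) u (chartAt (Fin n → ℂ) j) y) =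
        ∫ y in (chartAt (Fin n → ℂ) i).target,
          partition n X j ((chartAt (Fin n → ℂ) i).symm y) *
            (f ((chartAt (Fin n → ℂ) i).symm y) *
              gradPairing g (partition n X i) u (chartAt (Fin n → ℂ) i) y) := by
      intro j _
      refine setIntegral_eq_of_isTopForm (isTopForm_mul (partition n X j) (isTopForm_mul f
        (isTopForm_gradPairing hg (isChartSmooth_partition i) hu))) (hmem j) (hmem i) ?_ ?_
      · intro y hy h
        rw [hzero i _ y hy fun h' => h (tsupport_partition_subset i h')]
        simp
      · intro y hy h
        rw [image_eq_zero_of_notMem_tsupport fun h' => h (tsupport_partition_subset j h'), zero_mul]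
    rw [Finset.sum_congr rfl h2, ← integral_finsetSum]
    · refine setIntegral_congr_fun (chartAt (Fin n → ℂ) i).open_target.measurableSet fun y hy => ?_
      rw [← Finset.sum_mul, hs, one_mul]
    · intro j _
      refine integrableOn_of_continuousOn (chartAt (Fin n → ℂ) i).open_target
        (isCompact_chartSupport i) (chartSupport_subset i)
        ((isChartSmooth_partition j _ (hmem i)).continuousOn.fun_mul (hcont i i)) fun y hy h => ?_
      rw [hzero i _ y hy (notMem_tsupport hy h)]
      simp
  rw [Finset.sum_congr rfl h1, Finset.sum_comm]
  refine Finset.sum_eq_zero fun j _ => ?_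
  rw [← integral_finsetSum _ fun i _ => integrableOn_partition_mul j (hcont i j)]
  refine setIntegral_eq_zero_of_forall_eq_zero fun y hy => ?_
  rw [← Finset.mul_sum, ← Finset.mul_sum]
  -- All terms now live in one chart, where the gradients add up to the gradient of the constant
  -- `1`.
  have h3 : ∑ i ∈ s, gradVec (partition n X i) (chartAt (Fin n → ℂ) j) y = 0 := by
    funext k
    rw [Finset.sum_apply]
    simp only [gradVec]
    rw [← dz_sum _ _ fun i _ => (isChartSmooth_partition i).differentiableAt_ofReal (hmem j) hy]
    have : (fun z => ∑ i ∈ s, (partition n X i ((chartAt (Fin n → ℂ) j).symm z) : ℂ)) =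
        fun _ => 1 := by
      funext z
      rw [← Complex.ofReal_sum, hs, Complex.ofReal_one]
    rw [this, dz_const]
    rfl
  have h4 : ∑ i ∈ s, gradPairing g (partition n X i) u (chartAt (Fin n → ℂ) j) y = 0 := by
    simp only [gradPairing]
    rw [← Complex.re_sum, ← dotProduct_sum, ← Matrix.mulVec_sum, h3]
    simp
  rw [h4, mul_zero, mul_zero]

/-- Integration by parts: `∫ f i∂∂̄u ∧ g ^ (n - 1) = -∫ i∂f ∧ ∂̄u ∧ g ^ (n - 1)`. -/
theorem integral_traceForm_ddbar {g : ChartForm n X} (hg : IsKahlerForm g)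
    {f u : X → ℝ} (hf : IsChartSmooth n f) (hu : IsChartSmooth n u) :
    integral f (traceForm g (ddbar u)) = - integral (fun _ => 1) (gradPairing g f u) := by
  obtain ⟨s, hs, hs1⟩ := exists_finset_partition (n := n) (X := X)
  have hmem := fun i : X => chart_mem_atlas (Fin n → ℂ) i
  -- The local formula with cutoff `ρ_i f`, split by `∂(ρ_i f) = ρ_i ∂f + f ∂ρ_i`. The last
  -- integrals cancel on summing over `i`.
  have key : ∀ i ∈ s, ∫ y in (chartAt (Fin n → ℂ) i).target,
      partition n X i ((chartAt (Fin n → ℂ) i).symm y) * f ((chartAt (Fin n → ℂ) i).symm y) *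
        traceForm g (ddbar u) (chartAt (Fin n → ℂ) i) y =
      - (∫ y in (chartAt (Fin n → ℂ) i).target,
        partition n X i ((chartAt (Fin n → ℂ) i).symm y) * 1 *
          gradPairing g f u (chartAt (Fin n → ℂ) i) y) -
      ∫ y in (chartAt (Fin n → ℂ) i).target, f ((chartAt (Fin n → ℂ) i).symm y) *
        gradPairing g (partition n X i) u (chartAt (Fin n → ℂ) i) y := by
    intro i _
    have h := setIntegral_mul_trace_adjugate (chartAt (Fin n → ℂ) i).open_target
      (isCompact_chartSupport i) (chartSupport_subset i) (hg.smooth _ (hmem i))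
      (fun y hy l j k => (hg.closed _ (hmem i) y hy l j k).1) (hu _ (hmem i))
      ((isChartSmooth_partition i).mul hf _ (hmem i))
      fun y hy hyK => by simp only [partition_eq_zero hy hyK, zero_mul]
    have h' : ∫ y in (chartAt (Fin n → ℂ) i).target,
        partition n X i ((chartAt (Fin n → ℂ) i).symm y) * f ((chartAt (Fin n → ℂ) i).symm y) *
          traceForm g (ddbar u) (chartAt (Fin n → ℂ) i) y =
        - ∫ y in (chartAt (Fin n → ℂ) i).target,
          gradPairing g (fun x => partition n X i x * f x) u (chartAt (Fin n → ℂ) i) y := h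
    rw [h', ← neg_add', ← integral_add]
    · congr 1
      refine setIntegral_congr_fun (chartAt (Fin n → ℂ) i).open_target.measurableSet fun y hy => ?_
      rw [gradPairing_add_left g (gradVec_mul (isChartSmooth_partition i) hf (hmem i) hy), mul_one]
    · simp only [mul_assoc]
      exact integrableOn_partition_mul i (continuousOn_const.fun_mul
        (continuousOn_gradPairing hg.toIsHermitianMetric hf hu _ (hmem i)))
    · refine integrableOn_of_continuousOn (chartAt (Fin n → ℂ) i).open_target
        (isCompact_chartSupport i) (chartSupport_subset i)
        ((hf _ (hmem i)).continuousOn.fun_mul (continuousOn_gradPairing hg.toIsHermitianMetric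
          (isChartSmooth_partition i) hu _ (hmem i))) fun y hy h => ?_
      rw [gradPairing, gradVec_eq_zero hy (notMem_tsupport hy h)]
      simp
  rw [integral_eq_sum hs, integral_eq_sum hs, Finset.sum_congr rfl key, Finset.sum_sub_distrib,
    sum_setIntegral_gradPairing_partition hg.toIsHermitianMetric hf hu hs1, sub_zero,
    Finset.sum_neg_distrib]

/-- Self-adjointness of the Laplacian of `g`, since the gradient pairing is symmetric. -/
theorem integral_traceForm_ddbar_comm {g : ChartForm n X} (hg : IsKahlerForm g)
    {f u : X → ℝ} (hf : IsChartSmooth n f) (hu : IsChartSmooth n u) :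
    integral f (traceForm g (ddbar u)) = integral u (traceForm g (ddbar f)) := by
  rw [integral_traceForm_ddbar hg hf hu, integral_traceForm_ddbar hg hu hf]
  congr 1
  exact integral_congr fun e he y hy => by
    rw [gradPairing_comm hg.toIsHermitianMetric f u he hy]

end Integral

/-! ### Ricci forms and the comparison of the energies -/

section Energy

theorem dz_dzbar_add {n : ℕ} {U : Set (Fin n → ℂ)} (hU : IsOpen U) {f f' : (Fin n → ℂ) → ℝ}
    (hf : ContDiffOn ℝ ∞ f U) (hf' : ContDiffOn ℝ ∞ f' U) {y : Fin n → ℂ} (hy : y ∈ U)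
    (j k : Fin n) :
    dz j (dzbar k fun z => ((f z + f' z : ℝ) : ℂ)) y =
      dz j (dzbar k fun z => (f z : ℂ)) y + dz j (dzbar k fun z => (f' z : ℂ)) y := by
  have hd : ∀ {w : (Fin n → ℂ) → ℂ}, ContDiffOn ℝ ∞ w U → ∀ z ∈ U, DifferentiableAt ℝ w z :=
    fun hw z hz => (hw.contDiffAt (hU.mem_nhds hz)).differentiableAt (by simp)
  have h : (dzbar k fun z => ((f z + f' z : ℝ) : ℂ)) =ᶠ[nhds y]
      fun z => dzbar k (fun z => (f z : ℂ)) z + dzbar k (fun z => (f' z : ℂ)) z := by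
    filter_upwards [hU.mem_nhds hy] with z hz
    simp only [Complex.ofReal_add, dzbar,
      fderiv_fun_add (hd (contDiffOn_ofReal hf) z hz) (hd (contDiffOn_ofReal hf') z hz)]
    simp only [add_apply]
    ring
  rw [dz_congr j h, dz_add j (hd (contDiffOn_dzbar hU k (contDiffOn_ofReal hf)) y hy)
    (hd (contDiffOn_dzbar hU k (contDiffOn_ofReal hf')) y hy)]

variable {n : ℕ} {X : Type*} [TopologicalSpace X]

theorem traceForm_self (g : ChartForm n X) (e : OpenPartialHomeomorph X (Fin n → ℂ))
    (y : Fin n → ℂ) : traceForm g g e y = n * (g e y).det.re := by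
  rw [traceForm, Matrix.adjugate_mul, Matrix.trace_smul, Matrix.trace_one, Fintype.card_fin,
    smul_eq_mul, mul_comm]
  simp

theorem traceForm_eq_add {g α β γ : ChartForm n X} {e : OpenPartialHomeomorph X (Fin n → ℂ)}
    {y : Fin n → ℂ} (h : α e y = β e y + γ e y) :
    traceForm g α e y = traceForm g β e y + traceForm g γ e y := by
  rw [traceForm, h, Matrix.mul_add, Matrix.trace_add, Complex.add_re]
  rfl

theorem wedgePow_one_eq_traceForm (hn : 1 ≤ n) (α g : ChartForm n X)
    (e : OpenPartialHomeomorph X (Fin n → ℂ)) (y : Fin n → ℂ) :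
    wedgePow 1 α g e y = 2 ^ n * (n - 1).factorial * traceForm g α e y :=
  wedgePow_one_apply hn α g e y

/-- Since `n - 1 = (n + 1) - 2`, the weight `b_k / (n + 1)` is `-2 / (n + 1)`, plus `1` when `k ≤
1`. -/
theorem sum_bCoeff (hn : 1 ≤ n) (a : ℕ → ℝ) :
    ∑ k ∈ Finset.range (n + 1), bCoeff n k / ((n : ℝ) + 1) * a k =
      a 0 + a 1 - 2 * (1 / ((n : ℝ) + 1) * ∑ k ∈ Finset.range (n + 1), a k) := by
  obtain ⟨m, rfl⟩ : ∃ m, n = m + 1 := ⟨n - 1, by omega⟩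
  have h : (((m + 1 : ℕ) : ℝ) + 1) ≠ 0 := by positivity
  have hb : ∀ k, bCoeff (m + 1) (k + 1 + 1) = -2 := fun k => by simp [bCoeff]
  rw [Finset.sum_range_succ', Finset.sum_range_succ', Finset.sum_range_succ' a,
    Finset.sum_range_succ' fun k => a (k + 1)]
  simp only [hb, ← Finset.mul_sum]
  simp only [bCoeff, zero_add, le_refl, if_true, zero_le]
  field_simp
  ring

theorem wedgePow_self_eq_traceForm (hn : 1 ≤ n) (k : ℕ) (g : ChartForm n X)
    (e : OpenPartialHomeomorph X (Fin n → ℂ)) (y : Fin n → ℂ) :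
    wedgePow k g g e y = 2 ^ n * (n - 1).factorial * traceForm g g e y := by
  rw [wedgePow_self_apply, traceForm_self, ← Nat.mul_factorial_pred (by omega : n ≠ 0)]
  push_cast
  ring

theorem traceForm_gradForm (g : ChartForm n X) {u : X → ℝ}
    {e : OpenPartialHomeomorph X (Fin n → ℂ)} {y : Fin n → ℂ}
    (hu : DifferentiableAt ℝ (fun z => u (e.symm z)) y) :
    traceForm g (gradForm u) e y = gradPairing g u u e y := by
  rw [traceForm, gradPairing]
  congr 1
  simp only [Matrix.trace, Matrix.diag_apply, Matrix.mul_apply, Matrix.mulVec, dotProduct,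
    Pi.star_apply, Finset.mul_sum, gradForm, Matrix.of_apply, gradVec]
  refine Finset.sum_congr rfl fun k _ => Finset.sum_congr rfl fun j _ => ?_
  rw [dzbar_ofReal k hu]
  ring

variable [ChartedSpace (Fin n → ℂ) X]

theorem IsChartSmooth.add {f u : X → ℝ} (hf : IsChartSmooth n f) (hu : IsChartSmooth n u) :
    IsChartSmooth n fun x => f x + u x := fun e he => (hf e he).add (hu e he)

theorem IsChartSmooth.sub {f u : X → ℝ} (hf : IsChartSmooth n f) (hu : IsChartSmooth n u) :
    IsChartSmooth n fun x => f x - u x := fun e he => (hf e he).sub (hu e he)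

theorem IsKahlerForm.congr {g g' : ChartForm n X} (hg : IsKahlerForm g) (h : FormEq g g') :
    IsKahlerForm g' where
  smooth e he j k := (hg.smooth e he j k).congr fun y hy => by rw [h e he y hy]
  compatible e he e' he' x hx := by
    rw [← h e he _ (e.map_source hx.1), ← h e' he' _ (e'.map_source hx.2)]
    exact hg.compatible e he e' he' x hx
  posDef e he y hy := h e he y hy ▸ hg.posDef e he y hy
  closed e he y hy l j k := by
    have hev : ∀ a b, (fun z => g' e z a b) =ᶠ[nhds y] fun z => g e z a b := fun a b => by
      filter_upwards [e.open_target.mem_nhds hy] with z hz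
      rw [h e he z hz]
    rw [dz_congr l (hev j k), dz_congr j (hev l k), dzbar_congr l (hev j k),
      dzbar_congr k (hev j l)]
    exact hg.closed e he y hy l j k

theorem continuousOn_traceForm {g α : ChartForm n X} (hg : IsHermitianMetric g)
    (hα : ∀ e ∈ atlas (Fin n → ℂ) X, ∀ j k, ContDiffOn ℝ ∞ (fun y => α e y j k) e.target) :
    IsContinuousForm (traceForm g α) := by
  intro e he
  change ContinuousOn (fun y => ((g e y).adjugate * α e y).trace.re) e.target
  simp only [Matrix.trace, Matrix.diag_apply, Matrix.mul_apply]
  exact Complex.continuous_re.comp_continuousOn (continuousOn_finsetSum _ fun k _ =>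
    continuousOn_finsetSum _ fun j _ => (contDiffOn_adjugate (hg.smooth e he) k j).continuousOn.mul
      (hα e he j k).continuousOn)

theorem IsChartSmooth.ddbar {f : X → ℝ} (hf : IsChartSmooth n f) :
    ∀ e ∈ atlas (Fin n → ℂ) X, ∀ j k,
      ContDiffOn ℝ ∞ (fun y => ddbar f e y j k) e.target := fun e he j k =>
  contDiffOn_dz e.open_target j (contDiffOn_dzbar e.open_target k (contDiffOn_ofReal (hf e he)))

/-- Both determinants scale by the same `|det J|²`, so the ratio, defined through the preferred
chart at the point, can be read in any chart. -/
theorem logRatio_symm {g η : ChartForm n X} (hg : IsHermitianMetric g) (hη : IsHermitianMetric η)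
    {e : OpenPartialHomeomorph X (Fin n → ℂ)} (he : e ∈ atlas (Fin n → ℂ) X) {y : Fin n → ℂ}
    (hy : y ∈ e.target) :
    logRatio g η (e.symm y) = Real.log (η e y).det.re - Real.log (g e y).det.re := by
  set x := e.symm y with hx
  have hxe : e x = y := e.right_inv hy
  have hxs : x ∈ (chartAt (Fin n → ℂ) x).source ∩ e.source :=
    ⟨mem_chart_source _ x, e.map_target hy⟩
  have hc := chart_mem_atlas (Fin n → ℂ) x
  have h1 := isTopForm_det hg _ hc e he x hxs
  have h2 := isTopForm_det hη _ hc e he x hxs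
  have h3 := det_re_pos hg hc (mem_chart_target (Fin n → ℂ) x)
  have h4 := det_re_pos hg he hy
  have h5 := det_re_pos hη he hy
  simp only [hxe] at h1 h2
  rw [h1] at h3
  -- The Jacobian factor is nonzero because `det g` is positive in both charts.
  have h6 : 0 < ‖(jacobian (chartAt (Fin n → ℂ) x) e (chartAt (Fin n → ℂ) x x)).det‖ ^ 2 :=
    pos_of_mul_pos_left h3 h4.le
  rw [logRatio, wedgePow_self_apply, wedgePow_self_apply, h1, h2, ← Real.log_div h5.ne' h4.ne',
    mul_div_mul_left _ _ (by positivity), mul_div_mul_left _ _ h6.ne']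

theorem contDiffOn_log_det {g : ChartForm n X} (hg : IsHermitianMetric g)
    {e : OpenPartialHomeomorph X (Fin n → ℂ)} (he : e ∈ atlas (Fin n → ℂ) X) :
    ContDiffOn ℝ ∞ (fun y => Real.log (g e y).det.re) e.target :=
  (Complex.reCLM.contDiff.comp_contDiffOn (contDiffOn_det (hg.smooth e he))).log
    fun _ hy => (det_re_pos hg he hy).ne'

theorem isChartSmooth_logRatio {g η : ChartForm n X} (hg : IsHermitianMetric g)
    (hη : IsHermitianMetric η) : IsChartSmooth n (logRatio g η) := fun _ he =>
  ((contDiffOn_log_det hη he).sub (contDiffOn_log_det hg he)).congr fun _ hy =>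
    logRatio_symm hg hη he hy

/-- The Ricci form of `η = ω₀ + i∂∂̄φ` is `η - i∂∂̄u` for `u = log (η ^ n / ω₀ ^ n) + φ - h`. -/
theorem ricci_add_ddbar {ω₀ : ChartForm n X} {h φ : X → ℝ} (hω : IsHermitianMetric ω₀)
    (hη : IsHermitianMetric (ω₀ + ddbar φ)) (hh : IsChartSmooth n h) (hφ : IsChartSmooth n φ)
    (hric : FormEq (ricci ω₀) (ω₀ + ddbar h)) :
    FormEq (ricci (ω₀ + ddbar φ)) (ω₀ + ddbar φ -
      ddbar fun x => logRatio ω₀ (ω₀ + ddbar φ) x + φ x - h x) := by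
  intro e he y hy
  ext j k
  have hu := ((isChartSmooth_logRatio hω hη).add hφ).sub hh e he
  have hUo := e.open_target
  have h1 := dz_dzbar_add hUo (hu.add (contDiffOn_log_det hω he)) (hh e he) hy j k
  have h2 := dz_dzbar_add hUo hu (contDiffOn_log_det hω he) hy j k
  have h3 := dz_dzbar_add hUo (contDiffOn_log_det hη he) (hφ e he) hy j k
  -- In the chart, `u + log det ω₀ + h = log det η + φ`. Applying `i∂∂̄` and `Ric ω₀ = ω₀ + i∂∂̄h`
  -- gives the claim.
  have h4 : (dzbar k fun z => ((logRatio ω₀ (ω₀ + ddbar φ) (e.symm z) + φ (e.symm z) -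
      h (e.symm z) + Real.log (ω₀ e z).det.re + h (e.symm z) : ℝ) : ℂ)) =ᶠ[nhds y]
      dzbar k fun z => ((Real.log ((ω₀ + ddbar φ : ChartForm n X) e z).det.re + φ (e.symm z) : ℝ) : ℂ) := by
    filter_upwards [hUo.mem_nhds hy] with z hz
    refine dzbar_congr k ?_
    filter_upwards [hUo.mem_nhds hz] with w hw
    rw [logRatio_symm hω hη he hw]
    congr 1
    ring
  rw [dz_congr j h4, h3, h2] at h1
  have h5 := congrFun (congrFun (hric e he y hy) j) k
  simp only [Pi.add_apply, Pi.sub_apply, Matrix.add_apply, Matrix.sub_apply, ddbar, ricci,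
    Matrix.of_apply] at h1 h5 ⊢
  linear_combination -h1 + h5

variable [IsManifold 𝓘(ℂ, Fin n → ℂ) ω X] [T2Space X] [CompactSpace X]

/-- The constant relating the Chen–Tian energy to the K-energy. -/
def energyConstant (ω₀ : ChartForm n X) (h : X → ℝ) : ℝ :=
  average ω₀ h (wedgePow 1 (ricci ω₀ + ω₀) ω₀) - 2 * average ω₀ h (wedgePow n ω₀ ω₀)

/-- Here `Ric ω₀ + ω₀ = 2ω₀ + i∂∂̄h`, and the `2ω₀` part is what the second average removes. -/
theorem energyConstant_eq (hn : 1 ≤ n) {ω₀ : ChartForm n X} (hω : IsKahlerForm ω₀) {h : X → ℝ}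
    (hh : IsRicciPotential ω₀ h) :
    energyConstant ω₀ h = (integral (fun _ => 1) (wedgePow n ω₀ ω₀))⁻¹ *
      (2 ^ n * (n - 1).factorial * integral h (traceForm ω₀ (ddbar h))) := by
  have hs := isChartSmooth_of_contMDiff hh.smooth
  have e1 : integral h (wedgePow n ω₀ ω₀) =
      2 ^ n * (n - 1).factorial * integral h (traceForm ω₀ ω₀) :=
    integral_const_mul_of_eq _ fun e he y hy => by
      rw [wedgePow_self_eq_traceForm hn]; ring
  have e2 := integral_eq_sum_mul (f := h) (Ω := wedgePow 1 (ricci ω₀ + ω₀) ω₀)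
    ![2 * (2 ^ n * (n - 1).factorial), 2 ^ n * (n - 1).factorial] ![h, h]
    ![traceForm ω₀ ω₀, traceForm ω₀ (ddbar h)]
    (fun e he y hy => by
      have h1 : traceForm ω₀ (ricci ω₀ + ω₀) e y =
          traceForm ω₀ (ricci ω₀) e y + traceForm ω₀ ω₀ e y := traceForm_eq_add rfl
      have h2 : traceForm ω₀ (ricci ω₀) e y =
          traceForm ω₀ ω₀ e y + traceForm ω₀ (ddbar h) e y :=
        traceForm_eq_add (hh.ricci_eq e he y hy)
      rw [wedgePow_one_eq_traceForm hn, h1, h2]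
      simp [Fin.sum_univ_succ]
      ring)
    (by simp [Fin.forall_fin_succ, hs])
    (by
      simp [Fin.forall_fin_succ, continuousOn_traceForm hω.toIsHermitianMetric hω.smooth,
        continuousOn_traceForm hω.toIsHermitianMetric hs.ddbar])
  simp [Fin.sum_univ_succ] at e2
  rw [energyConstant, average, average, e1, e2]
  ring

/-- Two Ricci potentials have the same `i∂∂̄`, and the symmetric pairing `∫ h i∂∂̄h' ∧ ω₀ ^ (n - 1)`
allows exchanging one factor at a time. This bypasses showing `h = h'`. -/
theorem energyConstant_unique (hn : 1 ≤ n) {ω₀ : ChartForm n X} (hω : IsKahlerForm ω₀)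
    {h h' : X → ℝ} (hh : IsRicciPotential ω₀ h) (hh' : IsRicciPotential ω₀ h') :
    energyConstant ω₀ h = energyConstant ω₀ h' := by
  have hs := isChartSmooth_of_contMDiff hh.smooth
  have hs' := isChartSmooth_of_contMDiff hh'.smooth
  have key : ∀ e ∈ atlas (Fin n → ℂ) X, ∀ y ∈ e.target,
      traceForm ω₀ (ddbar h) e y = traceForm ω₀ (ddbar h') e y := by
    intro e he y hy
    have h1 : ω₀ e y + ddbar h e y = ω₀ e y + ddbar h' e y :=
      (hh.ricci_eq e he y hy).symm.trans (hh'.ricci_eq e he y hy)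
    rw [traceForm, traceForm, add_left_cancel h1]
  rw [energyConstant_eq hn hω hh, energyConstant_eq hn hω hh']
  congr 2
  calc integral h (traceForm ω₀ (ddbar h)) = integral h (traceForm ω₀ (ddbar h')) :=
        integral_congr fun e he y hy => by rw [key e he y hy]
    _ = integral h' (traceForm ω₀ (ddbar h)) := integral_traceForm_ddbar_comm hω hs hs'
    _ = integral h' (traceForm ω₀ (ddbar h')) :=
        integral_congr fun e he y hy => by rw [key e he y hy]

/-- The Chen–Tian energy in terms of the K-energy and the gradient of
`log (ω_φ ^ n / ω₀ ^ n) + φ - h`. -/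
theorem chenTianE1_eq (hn : 1 ≤ n) {ω₀ : ChartForm n X} (hω : IsKahlerForm ω₀) {h φ : X → ℝ}
    (hh : IsRicciPotential ω₀ h) (hφ : IsChartSmooth n φ) (hη : IsKahlerForm (ω₀ + ddbar φ)) :
    chenTianE1 ω₀ h φ = 2 * kEnergy ω₀ h φ +
      average ω₀ (fun _ => 1) (wedgePow 1
        (gradForm fun x => logRatio ω₀ (ω₀ + ddbar φ) x + φ x - h x) (ω₀ + ddbar φ)) +
      energyConstant ω₀ h := by
  have hs := isChartSmooth_of_contMDiff hh.smooth
  have hu : IsChartSmooth n fun x => logRatio ω₀ (ω₀ + ddbar φ) x + φ x - h x :=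
    ((isChartSmooth_logRatio hω.toIsHermitianMetric hη.toIsHermitianMetric).add hφ).sub hs
  have hric := ricci_add_ddbar hω.toIsHermitianMetric hη.toIsHermitianMetric hs hφ hh.ricci_eq
  have hL : (fun x => logRatio ω₀ (ω₀ + ddbar φ) x - h x) =
      fun x => (logRatio ω₀ (ω₀ + ddbar φ) x + φ x - h x) - φ x := by
    funext x; ring
  rw [chenTianE1, kEnergy, hL, sum_bCoeff hn, wedgePow_zero, energyConstant]
  -- From here `u`, and below `η`, are opaque: only `Ric η = η - i∂∂̄u` and `η = ω₀ + i∂∂̄φ` are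
  -- needed.
  generalize hue : (fun x => logRatio ω₀ (ω₀ + ddbar φ) x + φ x - h x) = u at *
  have hux : ∀ x, logRatio ω₀ (ω₀ + ddbar φ) x + φ x - h x = u x := fun x => congrFun hue x
  simp only [hux]
  have hadd : ∀ e y, (ω₀ + ddbar φ : ChartForm n X) e y = ω₀ e y + ddbar φ e y := fun _ _ => rfl
  generalize hηe : (ω₀ + ddbar φ : ChartForm n X) = η at *
  have c1 := continuousOn_traceForm hη.toIsHermitianMetric hη.smooth
  have c2 := continuousOn_traceForm hη.toIsHermitianMetric hφ.ddbar
  have c3 := continuousOn_traceForm hη.toIsHermitianMetric hu.ddbar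
  have tω : ∀ e y, traceForm η η e y = traceForm η ω₀ e y + traceForm η (ddbar φ) e y :=
    fun e y => traceForm_eq_add (hadd e y)
  set c : ℝ := 2 ^ n * (n - 1).factorial with hc
  have e1 : ∀ f, integral f (wedgePow n η η) = c * integral f (traceForm η η) := fun f =>
    integral_const_mul_of_eq _ fun e he y hy => by
      rw [wedgePow_self_eq_traceForm hn]; ring
  have e2 := integral_eq_sum_mul (f := φ) (Ω := wedgePow 1 ω₀ η) ![c, -c] ![φ, φ]
    ![traceForm η η, traceForm η (ddbar φ)]
    (fun e he y hy => by
      rw [wedgePow_one_eq_traceForm hn]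
      simp [Fin.sum_univ_succ]
      rw [tω]
      ring)
    (by simp [Fin.forall_fin_succ, hφ])
    (by simp [Fin.forall_fin_succ, c1, c2])
  -- The six coefficients are those of the product `(u - φ)(2η - i∂∂̄φ - i∂∂̄u)`.
  have e3 := integral_eq_sum_mul (f := fun x => u x - φ x) (Ω := wedgePow 1 (ricci η + ω₀) η)
    ![2 * c, -2 * c, -c, c, -c, c] ![u, φ, u, φ, u, φ]
    ![traceForm η η, traceForm η η, traceForm η (ddbar φ), traceForm η (ddbar φ),
      traceForm η (ddbar u), traceForm η (ddbar u)]
    (fun e he y hy => by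
      have h1 : traceForm η (ricci η + ω₀) e y = traceForm η (ricci η) e y + traceForm η ω₀ e y :=
        traceForm_eq_add rfl
      have h2 : traceForm η η e y = traceForm η (ricci η) e y + traceForm η (ddbar u) e y :=
        traceForm_eq_add (by rw [hric e he y hy]; exact (sub_add_cancel _ _).symm)
      have h3 := tω e y
      have h4 : traceForm η (ricci η) e y = traceForm η η e y - traceForm η (ddbar u) e y := by
        linarith
      have h5 : traceForm η ω₀ e y = traceForm η η e y - traceForm η (ddbar φ) e y := by
        linarith
      rw [wedgePow_one_eq_traceForm hn, h1, h4, h5]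
      simp [Fin.sum_univ_succ]
      ring)
    (by simp [Fin.forall_fin_succ, hφ, hu])
    (by simp [Fin.forall_fin_succ, c1, c2, c3])
  have e4 : integral (fun _ => 1) (wedgePow 1 (gradForm u) η) =
      -c * integral u (traceForm η (ddbar u)) := by
    rw [integral_traceForm_ddbar hη hu hu, neg_mul_neg]
    exact integral_const_mul_of_eq _ fun e he y hy => by
      rw [wedgePow_one_eq_traceForm hn, traceForm_gradForm η (hu.differentiableAt he hy)]
      ring
  -- This cancels the two mixed terms of `e3`.
  have e5 := integral_traceForm_ddbar_comm hη hu hφ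
  simp [Fin.sum_univ_succ] at e2 e3
  simp only [average, e1, e2, e3, e4, e5]
  ring

theorem average_gradForm_nonneg (hn : 1 ≤ n) {ω₀ η : ChartForm n X} (hω : IsHermitianMetric ω₀)
    (hη : IsHermitianMetric η) {u : X → ℝ} (hu : IsChartSmooth n u) :
    0 ≤ average ω₀ (fun _ => 1) (wedgePow 1 (gradForm u) η) := by
  refine mul_nonneg (inv_nonneg.mpr (integral_nonneg fun e he y hy => ?_))
    (integral_nonneg fun e he y hy => ?_)
  · have := det_re_pos hω he hy
    rw [wedgePow_self_apply]
    positivity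
  · have := gradPairing_self_nonneg hη u he hy
    rw [wedgePow_one_eq_traceForm hn, traceForm_gradForm η (hu.differentiableAt he hy)]
    positivity

theorem average_gradForm_congr (hn : 1 ≤ n) {ω₀ η η' : ChartForm n X} (h : FormEq η η')
    (u : X → ℝ) :
    average ω₀ (fun _ => 1) (wedgePow 1 (gradForm u) η) =
      average ω₀ (fun _ => 1) (wedgePow 1 (gradForm u) η') := by
  rw [average, average]
  congr 1
  exact integral_congr fun e he y hy => by
    rw [wedgePow_one_eq_traceForm hn, wedgePow_one_eq_traceForm hn, traceForm, traceForm,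
      h e he y hy]

end Energy

end KahlerRicci

end

theorem theorem2 (n : ℕ) (hn : 1 ≤ n) (X : Type*) [TopologicalSpace X] [T2Space X] [CompactSpace X]
    [ConnectedSpace X] [ChartedSpace (Fin n → ℂ) X]
    [IsManifold (modelWithCornersSelf ℂ (Fin n → ℂ)) (⊤ : WithTop ℕ∞) X]
    (ω₀ : KahlerRicci.ChartForm n X) (hω : KahlerRicci.IsKahlerForm ω₀)
    (hc1 : KahlerRicci.InTwoPiC1 ω₀) :
    ∃ C : ℝ, ∀ h : X → ℝ, KahlerRicci.IsRicciPotential ω₀ h →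
      ∀ ωt : ℝ → KahlerRicci.ChartForm n X, KahlerRicci.IsKahlerRicciFlow ωt →
        (∀ t : ℝ, 0 ≤ t → ∀ φ : X → ℝ, KahlerRicci.IsKahlerPotential ω₀ φ →
          KahlerRicci.FormEq (ωt t) (ω₀ + KahlerRicci.ddbar φ) →
            KahlerRicci.chenTianE1 ω₀ h φ ≥ 2 * KahlerRicci.kEnergy ω₀ h φ + C) ∧
        (∀ φ φ' : ℝ → X → ℝ, KahlerRicci.IsPotentialFlow ω₀ h φ φ' →
          (∀ t : ℝ, 0 ≤ t → KahlerRicci.FormEq (ωt t) (ω₀ + KahlerRicci.ddbar (φ t))) →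
            ∀ t : ℝ, 0 ≤ t →
              KahlerRicci.chenTianE1 ω₀ h (φ t) = 2 * KahlerRicci.kEnergy ω₀ h (φ t) +
                KahlerRicci.average ω₀ (fun _ => 1)
                  (KahlerRicci.wedgePow 1 (KahlerRicci.gradForm (φ' t)) (ωt t)) + C) := by
  classical
  -- The constant precedes `h` in the statement, so it is computed from a chosen Ricci potential;
  -- `energyConstant_unique` then passes to the given `h`. The default `0` is harmless: without a
  -- Ricci potential nothing is claimed.
  refine ⟨if H : ∃ h, KahlerRicci.IsRicciPotential ω₀ h then
    KahlerRicci.energyConstant ω₀ H.choose else 0, fun h hh ωt hωt => ?_⟩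
  have H : ∃ h, KahlerRicci.IsRicciPotential ω₀ h := ⟨h, hh⟩
  rw [dif_pos H, KahlerRicci.energyConstant_unique hn hω H.choose_spec hh]
  refine ⟨fun t ht φ hφ heq => ?_, fun φ φ' hflow heq t ht => ?_⟩
  -- The flow is used here only to know that `ω₀ + i∂∂̄φ` is a Kähler form.
  · have hη := (hωt.kahler t ht).congr heq
    have hs := KahlerRicci.isChartSmooth_of_contMDiff hφ.smooth
    have hu := ((KahlerRicci.isChartSmooth_logRatio hω.toIsHermitianMetric
      hη.toIsHermitianMetric).add hs).sub (KahlerRicci.isChartSmooth_of_contMDiff hh.smooth)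
    have := KahlerRicci.average_gradForm_nonneg hn hω.toIsHermitianMetric
      hη.toIsHermitianMetric hu
    rw [KahlerRicci.chenTianE1_eq hn hω hh hs hη]
    linarith
  · have hη := (hωt.kahler t ht).congr (heq t ht)
    have hs := KahlerRicci.isChartSmooth_of_contMDiff (hflow.potential t ht).smooth
    -- The flow equation identifies `φ' t` with the function `u` of `chenTianE1_eq`.
    rw [KahlerRicci.average_gradForm_congr hn (heq t ht), funext (hflow.flow t ht)]
    exact KahlerRicci.chenTianE1_eq hn hω hh hs hη
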